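/- For $n\ge 3$ let $C_n$ be the cycle on $n$ vertices. A lazy random walk on a graph stays, at each step, at its current vertex with probability $1/2$ and otherwise moves to a uniformly random neighbour. For an integer $k\ge 1$ run $k$ independent lazy random walks $X^{(1)},\dots,X^{(k)}$ on $C_n$, with start vertices sampled independently from the stationary distribution $\pi$ of a single walk (the uniform distribution on the vertices). Let $$\tau_{\mathsf{cov}}^{(k)}=\inf\Bigl\{t\ge 0:\ \bigcup_{s=0}^{t}\{X^{(1)}_s,\dots,X^{(k)}_s\}=V(C_n)\Bigr\}$$ be the first time at which every vertex has been visited by at least one of the walks, and let $t_{\mathsf{cov}}^{(k)}(\pi)=\mathbb E\bigl[\tau_{\mathsf{cov}}^{(k)}\bigr]$ be the stationary cover time of $k$ walks. Then $$t_{\mathsf{cov}}^{(k)}(\pi)=\Theta\Bigl(\Bigl(\frac nk\Bigr)^2\log^2 k\Bigr)\qquad\text{uniformly over } 2\le k\le n\log n .$$ The upper bound holds without any upper restriction on $k$. Explicitly, there are absolute constants $0<c,C<\infty$ such that, for all integers $n\ge 3$ and $k\ge 2$, $$t_{\mathsf{cov}}^{(k)}(\pi)\le C\Bigl(\frac nk\Bigr)^2\log^2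 k ,$$ and, if moreover $k\le n\log n$, $$t_{\mathsf{cov}}^{(k)}(\pi)\ge c\Bigl(\frac nk\Bigr)^2\log^2 k .$$ Here $\log$ is the natural logarithm. -/

import Mathlib

open MeasureTheory ProbabilityTheory
open scoped ENNReal

noncomputable section

/-- One step of the lazy simple random walk on a finite graph `G` from the vertex `v`: stay at `v`
with probability `1/2`, otherwise move to a uniformly random neighbour.
(At an isolated vertex, which occurs in a connected graph only if it has a single vertex,
the walk stays put.) -/
def lazyStep {V : Type*} [Fintype V] (G : SimpleGraph V) [DecidableRel G.Adj] (v : V) : PMF V :=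
  if h : (G.neighborFinset v).Nonempty then
    (PMF.uniformOfFintype Bool).bind fun stay =>
      if stay then PMF.pure v else PMF.uniformOfFinset (G.neighborFinset v) h
  else PMF.pure v

/-- The transition kernel of the lazy walk. -/
def lazyKernel {V : Type*} [Fintype V] [MeasurableSpace V] [DiscreteMeasurableSpace V]
    (G : SimpleGraph V) [DecidableRel G.Adj] : Kernel V V where
  toFun v := (lazyStep G v).toMeasure
  measurable' := Measurable.of_discrete

instance {V : Type*} [Fintype V] [MeasurableSpace V] [DiscreteMeasurableSpace V]
    (G : SimpleGraph V) [DecidableRel G.Adj] : IsMarkovKernel (lazyKernel G) :=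
  ⟨fun v => PMF.toMeasure.isProbabilityMeasure (lazyStep G v)⟩

/-- The transition kernels of the lazy walk, as kernels from histories `(x₀, …, x_t)`:
the next position depends on the current position `x_t` only. -/
def lazyHistoryKernel {V : Type*} [Fintype V] [MeasurableSpace V] [DiscreteMeasurableSpace V]
    (G : SimpleGraph V) [DecidableRel G.Adj] (t : ℕ) :
    Kernel ((i : Finset.Iic t) → (fun _ : ℕ => V) i) ((fun _ : ℕ => V) (t + 1)) :=
  (lazyKernel G).comap (fun x => x ⟨t, Finset.mem_Iic.2 le_rfl⟩) (measurable_pi_apply _)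

instance {V : Type*} [Fintype V] [MeasurableSpace V] [DiscreteMeasurableSpace V]
    (G : SimpleGraph V) [DecidableRel G.Adj] (t : ℕ) :
    IsMarkovKernel (lazyHistoryKernel G t) := by
  unfold lazyHistoryKernel; infer_instance

/-- The law, on trajectories `ℕ → V`, of the lazy walk `X₀, X₁, X₂, …` started at `X₀ = u`. -/
def walkLaw {V : Type*} [Fintype V] [MeasurableSpace V] [DiscreteMeasurableSpace V]
    (G : SimpleGraph V) [DecidableRel G.Adj] (u : V) : Measure (ℕ → V) :=
  Kernel.traj (X := fun _ : ℕ => V) (lazyHistoryKernel G) 0 (fun _ => u)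

/-- The law of `k` independent lazy walks started at `u 0, …, u (k - 1)`;
`ω i t` is the position of the `i`-th walk at time `t`. -/
def multiWalkLaw {V : Type*} [Fintype V] [MeasurableSpace V] [DiscreteMeasurableSpace V]
    (G : SimpleGraph V) [DecidableRel G.Adj] {k : ℕ} (u : Fin k → V) :
    Measure (Fin k → ℕ → V) :=
  Measure.pi fun i => walkLaw G (u i)

/-- The first time `t` by which every vertex has been visited by at least one of the `k` walks
(`∞` if this never happens). -/
def coverTime {V : Type*} {k : ℕ} (ω : Fin k → ℕ → V) : ℝ≥0∞ :=
  ⨅ (t : ℕ) (_ : ∀ v : V, ∃ s ≤ t, ∃ i : Fin k, ω i s = v), (t : ℝ≥0∞)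

/-- The expected cover time of `k` independent lazy walks from given start vertices. -/
def coverTimeFrom {V : Type*} [Fintype V] [MeasurableSpace V] [DiscreteMeasurableSpace V]
    (G : SimpleGraph V) [DecidableRel G.Adj] {k : ℕ} (u : Fin k → V) : ℝ≥0∞ :=
  ∫⁻ ω, coverTime ω ∂(multiWalkLaw G u)

/-- The stationary distribution `π(v) = d(v) / (2m)` of the walk, `m` being the number of edges. -/
def stationaryLaw {V : Type*} [Fintype V] [MeasurableSpace V]
    (G : SimpleGraph V) [DecidableRel G.Adj] : Measure V :=
  ∑ v : V, ((G.degree v : ℝ≥0∞) / (2 * G.edgeFinset.card)) • Measure.dirac v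

/-- The stationary cover time: the expected cover time of `k` independent lazy walks whose
start vertices are independent samples from the stationary distribution. -/
def stationaryCoverTime {V : Type*} [Fintype V] [MeasurableSpace V] [DiscreteMeasurableSpace V]
    (G : SimpleGraph V) [DecidableRel G.Adj] (k : ℕ) : ℝ≥0∞ :=
  ∫⁻ u : Fin k → V, coverTimeFrom G u ∂(Measure.pi fun _ => stationaryLaw G)

end

/-! Everything reduces to one walk: averaging over the start vertices turns the joint law into a
product of `k` copies of the stationary walk law (`stationaryCoverTime_eq`). Hence the probability
that all walks fail to cover a given set by time `t` is a `k`-th power, `avgMissProb t W ^ k`. The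
quantity `missProb` obeys a recursion in `t`, so bounds for a single walk become inductions.

Upper bound. Cut the cycle into arcs of `j + 1` vertices. Within time of order `j ^ 2`, a walk
started at an arc's left end or at most `j` steps to the left of it covers the arc with probability
bounded below (`missProb_arc_le`). A stationary walk therefore fails with probability at most `exp
(-c (j + 1) / n)`, and a union bound over about `n / j` arcs gives `measure_uncovered_le`. Once `j`
exceeds a multiple of `(n / k) log k`, the exponential beats the number of arcs, and the remaining
tail sums to order `(n / k) ^ 2`.

Lower bound. Take `s` to be a small multiple of `(n / k) log k` and `t` about `s ^ 2`. An
exponential barrier shows that a stationary walk hits a fixed vertex with probability `O(s / n)`,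
and hits both of two vertices at distance at least `D` with probability `O(exp (-D / s))`. With `D`
about `7 s log k` there are at least `√k` spaced vertices, each missed by all walks with probability
at least `k ^ (-1/4)` and nearly independently. The second moment method (`measure_uncovered_ge`)
then leaves one uncovered with probability at least `1/6`. If `s < 1`, it suffices that time `0`
does not cover, a coupon collector estimate; only here is `k ≤ n log n` needed. -/

noncomputable section

/-! ### A first-step recursion for the probability of missing a set. -/

section Recursion

variable {n : ℕ} [NeZero n]

open Classical in
/-- The probability that the lazy walk on the cycle started at `u` has not visited all of `W`
by time `t`, computed by conditioning on the first step. -/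
def missProb : ℕ → Set (Fin n) → Fin n → ℝ
  | 0, W, u => if W ⊆ {u} then 0 else 1
  | t + 1, W, u => 1 / 2 * missProb t (W \ {u}) u + 1 / 4 * missProb t (W \ {u}) (u + 1)
      + 1 / 4 * missProb t (W \ {u}) (u - 1)

lemma missProb_succ (t : ℕ) (W : Set (Fin n)) (u : Fin n) :
    missProb (t + 1) W u = 1 / 2 * missProb t (W \ {u}) u + 1 / 4 * missProb t (W \ {u}) (u + 1)
      + 1 / 4 * missProb t (W \ {u}) (u - 1) := rfl

lemma missProb_nonneg (t : ℕ) (W : Set (Fin n)) (u : Fin n) : 0 ≤ missProb t W u := by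
  induction t generalizing W u with
  | zero => unfold missProb; split_ifs <;> norm_num
  | succ t ih =>
    rw [missProb_succ]
    linarith [ih (W \ {u}) u, ih (W \ {u}) (u + 1), ih (W \ {u}) (u - 1)]

lemma missProb_le_one (t : ℕ) (W : Set (Fin n)) (u : Fin n) : missProb t W u ≤ 1 := by
  induction t generalizing W u with
  | zero => unfold missProb; split_ifs <;> norm_num
  | succ t ih =>
    rw [missProb_succ]
    linarith [ih (W \ {u}) u, ih (W \ {u}) (u + 1), ih (W \ {u}) (u - 1)]

lemma missProb_mono (t : ℕ) {W W' : Set (Fin n)} (h : W ⊆ W') (u : Fin n) :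
    missProb t W u ≤ missProb t W' u := by
  induction t generalizing W W' u with
  | zero =>
    unfold missProb
    by_cases hW : W' ⊆ {u}
    · simp [hW, h.trans hW]
    · simp only [hW, if_false]; split_ifs <;> norm_num
  | succ t ih =>
    simp only [missProb_succ]
    have hs : W \ {u} ⊆ W' \ {u} := Set.sdiff_subset_sdiff_left h
    linarith [ih hs u, ih hs (u + 1), ih hs (u - 1)]

lemma missProb_empty (t : ℕ) (u : Fin n) : missProb t ∅ u = 0 := by
  induction t generalizing u with
  | zero => simp [missProb]
  | succ t ih => simp [missProb_succ, ih]

lemma missProb_of_subset_singleton (t : ℕ) {W : Set (Fin n)} {u : Fin n} (h : W ⊆ {u}) :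
    missProb t W u = 0 := by
  cases t with
  | zero => simp [missProb, h]
  | succ t => simp [missProb_succ, Set.sdiff_eq_empty.2 h, missProb_empty]

lemma missProb_zero_of_not_subset {W : Set (Fin n)} {u : Fin n} (h : ¬ W ⊆ {u}) :
    missProb 0 W u = 1 := by
  simp [missProb, h]

lemma missProb_succ_le (t : ℕ) (W : Set (Fin n)) (u : Fin n) :
    missProb (t + 1) W u ≤ missProb t W u := by
  induction t generalizing W u with
  | zero =>
    by_cases h : W ⊆ {u}
    · simp [missProb_of_subset_singleton, h]
    · rw [missProb_zero_of_not_subset h]; exact missProb_le_one _ _ _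
  | succ t ih =>
    rw [missProb_succ (t + 1) W, missProb_succ t W]
    linarith [ih (W \ {u}) u, ih (W \ {u}) (u + 1), ih (W \ {u}) (u - 1)]

lemma missProb_antitone (W : Set (Fin n)) (u : Fin n) : Antitone fun t => missProb t W u :=
  antitone_nat_of_succ_le fun t => missProb_succ_le t W u

/-- Submultiplicativity, from the Markov property at time `s`. -/
lemma missProb_add_le {t : ℕ} {β : ℝ} (hβ : ∀ v : Fin n, missProb t Set.univ v ≤ β) (s : ℕ)
    (W : Set (Fin n)) (u : Fin n) : missProb (s + t) W u ≤ missProb s W u * β := by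
  induction s generalizing W u with
  | zero =>
    by_cases h : W ⊆ {u}
    · simp [missProb_of_subset_singleton, h]
    · rw [missProb_zero_of_not_subset h, zero_add, one_mul]
      exact (missProb_mono t (Set.subset_univ W) u).trans (hβ u)
  | succ s ih =>
    rw [Nat.succ_add, missProb_succ, missProb_succ]
    linarith [ih (W \ {u}) u, ih (W \ {u}) (u + 1), ih (W \ {u}) (u - 1)]

lemma missProb_mul_le {t : ℕ} {β : ℝ} (hβ : ∀ v : Fin n, missProb t Set.univ v ≤ β) (m : ℕ)
    (u : Fin n) : missProb (m * t) Set.univ u ≤ β ^ m := by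
  have hβ0 : 0 ≤ β := (missProb_nonneg t Set.univ u).trans (hβ u)
  induction m with
  | zero => simpa using missProb_le_one _ _ _
  | succ m ih =>
    rw [Nat.succ_mul, pow_succ]
    exact (missProb_add_le hβ _ _ _).trans (mul_le_mul_of_nonneg_right ih hβ0)

/-- The average of `missProb` over a uniform start vertex. -/
def avgMissProb (t : ℕ) (W : Set (Fin n)) : ℝ := (∑ u, missProb t W u) / n

end Recursion

/-! ### The Markov property of the trajectory law. -/

section WalkLaw

variable {V : Type*} [Fintype V] [MeasurableSpace V] [DiscreteMeasurableSpace V]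
  (G : SimpleGraph V) [DecidableRel G.Adj]

instance (u : V) : IsProbabilityMeasure (walkLaw G u) := by
  unfold walkLaw; infer_instance

/-- The joint law of the history up to `b` and the next position is the composition-product of the
history law with the step kernel. -/
lemma lintegral_walkLaw_succ (u : V) (b : ℕ)
    (H : ((i : Finset.Iic b) → (fun _ : ℕ => V) i) → V → ℝ≥0∞) :
    ∫⁻ ω, H (Preorder.frestrictLe b ω) (ω (b + 1)) ∂walkLaw G u
      = ∫⁻ ω, ∫⁻ y, H (Preorder.frestrictLe b ω) y ∂lazyKernel G (ω b) ∂walkLaw G u := by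
  have hm : Measurable (Function.uncurry H) := .of_discrete
  have h := Kernel.partialTraj_compProd_eq_map_traj (X := fun _ : ℕ => V)
    (κ := lazyHistoryKernel G) (a := 0) (b := b) (Nat.zero_le b) (x₀ := fun _ => u)
  have h1 : ∫⁻ ω, H (Preorder.frestrictLe b ω) (ω (b + 1)) ∂walkLaw G u
      = ∫⁻ p, Function.uncurry H p ∂((walkLaw G u).map
        (fun x => (Preorder.frestrictLe b x, x (b + 1)))) := by
    rw [lintegral_map hm (by fun_prop)]; rfl
  have h2 : (walkLaw G u).map (Preorder.frestrictLe b)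
      = Kernel.partialTraj (X := fun _ : ℕ => V) (lazyHistoryKernel G) 0 b (fun _ => u) :=
    Kernel.traj_map_frestrictLe_apply 0 b _
  rw [h1, walkLaw, ← h, Measure.lintegral_compProd hm, ← h2, lintegral_map .of_discrete (by fun_prop)]
  rfl

lemma lintegral_walkLaw_zero (u : V) (f : V → ℝ≥0∞) :
    ∫⁻ ω, f (ω 0) ∂walkLaw G u = f u := by
  have hm : Measurable fun ω : ℕ → V => f (ω 0) :=
    (Measurable.of_discrete (f := f)).comp (measurable_pi_apply 0)
  unfold walkLaw
  rw [Kernel.lintegral_traj _ hm]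
  simp [Function.updateFinset]

end WalkLaw

/-! ### Identifying the recursion with probabilities on the cycle. -/

section Cycle

variable {m : ℕ}

lemma lazyStep_cycleGraph_apply (u y : Fin (m + 3)) :
    lazyStep (SimpleGraph.cycleGraph (m + 3)) u y
      = 2⁻¹ * (if y = u then 1 else 0)
        + 2⁻¹ * (if y ∈ ({u - 1, u + 1} : Finset (Fin (m + 3))) then 2⁻¹ else 0) := by
  have hc : (SimpleGraph.cycleGraph (m + 3)).degree u = 2 :=
    SimpleGraph.cycleGraph_degree_three_le
  have hN : ((SimpleGraph.cycleGraph (m + 3)).neighborFinset u).Nonempty := by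
    rw [SimpleGraph.cycleGraph_neighborFinset]; simp
  rw [lazyStep, dif_pos hN, PMF.bind_apply, tsum_bool]
  simp only [PMF.uniformOfFintype_apply, PMF.uniformOfFinset_apply, PMF.pure_apply,
    SimpleGraph.card_neighborFinset_eq_degree, hc, Bool.false_eq_true, if_false, if_true]
  rw [SimpleGraph.cycleGraph_neighborFinset, add_comm]
  simp

lemma lintegral_lazyKernel_cycleGraph (u : Fin (m + 3)) {f : Fin (m + 3) → ℝ}
    (hf : ∀ v, 0 ≤ f v) :
    ∫⁻ y, ENNReal.ofReal (f y) ∂lazyKernel (SimpleGraph.cycleGraph (m + 3)) u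
      = ENNReal.ofReal (1 / 2 * f u + 1 / 4 * f (u + 1) + 1 / 4 * f (u - 1)) := by
  have hne : u - 1 ≠ u + 1 := by
    intro h
    have h3 := SimpleGraph.cycleGraph_degree_three_le (n := m) (v := u)
    rw [SimpleGraph.cycleGraph_degree_two_le, h] at h3
    simp at h3
  have h4 : (2⁻¹ * 2⁻¹ : ℝ≥0∞) = ENNReal.ofReal (1 / 4) := by
    rw [show (1 / 4 : ℝ) = 2⁻¹ * 2⁻¹ by norm_num, ENNReal.ofReal_mul (by norm_num),
      ENNReal.ofReal_inv_of_pos (by norm_num), ENNReal.ofReal_ofNat]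
  have h2 : (2⁻¹ : ℝ≥0∞) = ENNReal.ofReal (1 / 2) := by
    rw [one_div, ENNReal.ofReal_inv_of_pos (by norm_num), ENNReal.ofReal_ofNat]
  change ∫⁻ y, ENNReal.ofReal (f y) ∂(lazyStep (SimpleGraph.cycleGraph (m + 3)) u).toMeasure = _
  rw [lintegral_fintype]
  simp only [PMF.toMeasure_apply_singleton _ _ (measurableSet_singleton _),
    lazyStep_cycleGraph_apply, mul_add, Finset.sum_add_distrib, mul_ite, mul_one, mul_zero,
    Finset.sum_ite_eq', Finset.mem_univ, if_true, h4]
  rw [← Finset.sum_filter, Finset.filter_mem_eq_inter, Finset.univ_inter, Finset.sum_pair hne, h2,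
    ← ENNReal.ofReal_mul (hf _), ← ENNReal.ofReal_mul (hf _), ← ENNReal.ofReal_mul (hf _),
    ← ENNReal.ofReal_add, ← ENNReal.ofReal_add]
  · congr 1; ring
  all_goals linarith [hf u, hf (u - 1), hf (u + 1)]

/-- The set of trajectories that have not visited all of `W` by time `t`. -/
def missEvent {V : Type*} (t : ℕ) (W : Set V) : Set (ℕ → V) :=
  {ω | ¬ W ⊆ {v | ∃ s ≤ t, ω s = v}}

lemma measurableSet_missEvent {V : Type*} [Countable V] [MeasurableSpace V]
    [DiscreteMeasurableSpace V] (t : ℕ) (W : Set V) : MeasurableSet (missEvent t W) := by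
  have : missEvent t W = ⋃ v ∈ W, ⋂ s ≤ t, {ω : ℕ → V | ω s = v}ᶜ := by
    ext ω; simp [missEvent, Set.subset_def]
  rw [this]
  refine MeasurableSet.biUnion (Set.to_countable W) fun v _ => MeasurableSet.iInter fun s =>
    MeasurableSet.iInter fun _ => MeasurableSet.compl ?_
  exact measurableSet_eq_fun (measurable_pi_apply s) measurable_const

/-- Conditioning on the history at time `s`. Only vertices visited strictly before `s` are removed
from `W`, since `missProb` itself discards the current position. -/
lemma lintegral_missProb (W : Set (Fin (m + 3))) (u : Fin (m + 3)) (s r : ℕ) :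
    ∫⁻ ω, ENNReal.ofReal (missProb r (W \ {v | ∃ i < s, ω i = v}) (ω s))
        ∂walkLaw (SimpleGraph.cycleGraph (m + 3)) u
      = ENNReal.ofReal (missProb (s + r) W u) := by
  induction s generalizing r with
  | zero =>
    simp only [not_lt_zero, false_and, exists_false, Set.ofPred_false, Set.sdiff_empty, zero_add]
    exact lintegral_walkLaw_zero _ u fun v => ENNReal.ofReal (missProb r W v)
  | succ s ih =>
    have h := lintegral_walkLaw_succ (SimpleGraph.cycleGraph (m + 3)) u s
      (fun x y => ENNReal.ofReal (missProb r (W \ {v | ∃ i, x i = v}) y))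
    have hset (ω : ℕ → Fin (m + 3)) : {v | ∃ i < s + 1, ω i = v}
        = {v | ∃ i, (Preorder.frestrictLe (π := fun _ => Fin (m + 3)) s ω) i = v} := by
      ext v; simp
    have hset' (ω : ℕ → Fin (m + 3)) : W \ {v | ∃ i < s + 1, ω i = v}
        = (W \ {v | ∃ i < s, ω i = v}) \ {ω s} := by
      ext v; simp only [Nat.lt_succ_iff_lt_or_eq, Set.mem_sdiff, Set.mem_ofPred_eq,
        Set.mem_singleton_iff]; grind
    simp only [← hset] at h
    rw [h, show s + 1 + r = s + (r + 1) by ring, ← ih (r + 1)]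
    refine lintegral_congr fun ω => ?_
    rw [lintegral_lazyKernel_cycleGraph _ fun v => missProb_nonneg _ _ _, missProb_succ, hset']

lemma walkLaw_missEvent (t : ℕ) (W : Set (Fin (m + 3))) (u : Fin (m + 3)) :
    walkLaw (SimpleGraph.cycleGraph (m + 3)) u (missEvent t W)
      = ENNReal.ofReal (missProb t W u) := by
  rw [← add_zero t, ← lintegral_missProb W u t 0, add_zero,
    ← lintegral_indicator_one (measurableSet_missEvent t W)]
  refine lintegral_congr fun ω => ?_
  have : W \ {v | ∃ i < t, ω i = v} ⊆ {ω t} ↔ W ⊆ {v | ∃ s ≤ t, ω s = v} := by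
    simp only [Set.subset_def, Set.mem_sdiff, Set.mem_ofPred_eq, Set.mem_singleton_iff,
      Nat.le_iff_lt_or_eq]; grind
  by_cases hω : W ⊆ {v | ∃ s ≤ t, ω s = v}
  · rw [missProb_of_subset_singleton 0 (this.2 hω)]; simp [missEvent, hω]
  · rw [missProb_zero_of_not_subset (this.not.2 hω)]; simp [missEvent, hω]

/-- The law of the lazy walk on the cycle started from the uniform distribution. -/
def stationaryWalkLaw (m : ℕ) : Measure (ℕ → Fin (m + 3)) :=
  (stationaryLaw (SimpleGraph.cycleGraph (m + 3))).bind
    (walkLaw (SimpleGraph.cycleGraph (m + 3)))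

lemma stationaryLaw_cycleGraph :
    stationaryLaw (SimpleGraph.cycleGraph (m + 3))
      = ((m + 3 : ℕ) : ℝ≥0∞)⁻¹ • Measure.count := by
  have hd : ∀ v, (SimpleGraph.cycleGraph (m + 3)).degree v = 2 := fun v =>
    SimpleGraph.cycleGraph_degree_three_le
  have hs := (SimpleGraph.cycleGraph (m + 3)).sum_degrees_eq_twice_card_edges
  simp only [hd, Finset.sum_const, Finset.card_univ, Fintype.card_fin, smul_eq_mul] at hs
  have he : (SimpleGraph.cycleGraph (m + 3)).edgeFinset.card = m + 3 := by omega
  unfold stationaryLaw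
  simp only [hd, he]
  rw [← Finset.smul_sum]
  congr 1
  · rw [ENNReal.div_eq_inv_mul, ENNReal.mul_inv (by simp) (by simp), mul_assoc, mul_comm]
    rw [mul_assoc, Nat.cast_ofNat, ENNReal.mul_inv_cancel (by simp) (by simp), mul_one]
  · rw [Measure.count, Measure.sum_fintype]

instance : IsProbabilityMeasure (stationaryLaw (SimpleGraph.cycleGraph (m + 3))) := by
  rw [stationaryLaw_cycleGraph]
  constructor
  simp only [Measure.smul_apply, Measure.count_univ, smul_eq_mul]
  simp only [ENat.card_eq_coe_fintype_card, Fintype.card_fin]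
  exact ENNReal.inv_mul_cancel (by simp) (by simp)

instance : IsProbabilityMeasure (stationaryWalkLaw m) := by
  constructor
  rw [stationaryWalkLaw, Measure.bind_apply MeasurableSet.univ (Measurable.of_discrete).aemeasurable]
  simp

lemma stationaryWalkLaw_missEvent (t : ℕ) (W : Set (Fin (m + 3))) :
    (stationaryWalkLaw m).real (missEvent t W) = avgMissProb t W := by
  rw [Measure.real, stationaryWalkLaw, Measure.bind_apply (measurableSet_missEvent t W)
    (Measurable.of_discrete).aemeasurable, stationaryLaw_cycleGraph, lintegral_smul_measure,
    lintegral_count, tsum_fintype]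
  simp only [walkLaw_missEvent]
  rw [← ENNReal.ofReal_sum_of_nonneg fun u _ => missProb_nonneg _ _ _, smul_eq_mul,
    ENNReal.toReal_mul, ENNReal.toReal_ofReal (Finset.sum_nonneg fun u _ => missProb_nonneg _ _ _),
    ENNReal.toReal_inv, ENNReal.toReal_natCast, avgMissProb, div_eq_inv_mul]

/-- The trajectories of `k` walks that have not visited all vertices by time `t`. -/
def uncovered (V : Type*) (k t : ℕ) : Set (Fin k → ℕ → V) :=
  {ω | ¬ ∀ v : V, ∃ s ≤ t, ∃ i : Fin k, ω i s = v}

lemma uncovered_eq (V : Type*) (k t : ℕ) :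
    uncovered V k t = ⋃ v : V, Set.univ.pi fun _ => missEvent t {v} := by
  ext ω
  simp only [uncovered, missEvent, Set.mem_ofPred_eq, Set.mem_iUnion, Set.mem_univ_pi,
    Set.singleton_subset_iff, not_forall, not_exists, not_and]
  exact exists_congr fun v => ⟨fun h i s hs => h s hs i, fun h s hs i => h i s hs⟩

lemma measurableSet_uncovered (k t : ℕ) (V : Type*) [Countable V] [MeasurableSpace V]
    [DiscreteMeasurableSpace V] : MeasurableSet (uncovered V k t) := by
  rw [uncovered_eq]
  exact MeasurableSet.iUnion fun v => MeasurableSet.univ_pi fun _ => measurableSet_missEvent _ _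

lemma coverTime_le {V : Type*} {k t : ℕ} {ω : Fin k → ℕ → V} (h : ω ∉ uncovered V k t) :
    coverTime ω ≤ t :=
  iInf₂_le t (by simpa [uncovered] using h)

lemma le_coverTime {V : Type*} {k t : ℕ} {ω : Fin k → ℕ → V} (h : ω ∈ uncovered V k t) :
    ((t + 1 : ℕ) : ℝ≥0∞) ≤ coverTime ω := by
  refine le_iInf₂ fun r hr => ?_
  by_contra hlt
  have hrt : r ≤ t := by
    rw [not_le, Nat.cast_lt] at hlt; omega
  exact h fun v => (hr v).imp fun s hs => ⟨hs.1.trans hrt, hs.2⟩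

lemma measurable_coverTime {V : Type*} [Countable V] [MeasurableSpace V]
    [DiscreteMeasurableSpace V] (k : ℕ) :
    Measurable (coverTime : (Fin k → ℕ → V) → ℝ≥0∞) := by
  classical
  refine Measurable.iInf fun t => ?_
  have : (fun ω : Fin k → ℕ → V =>
      ⨅ (_ : ∀ v : V, ∃ s ≤ t, ∃ i : Fin k, ω i s = v), (t : ℝ≥0∞))
      = (uncovered V k t).piecewise (fun _ => ⊤) (fun _ => (t : ℝ≥0∞)) := by
    ext ω
    by_cases h : ω ∈ uncovered V k t
    · rw [Set.piecewise_eq_of_mem _ _ _ h, iInf_neg h]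
    · rw [Set.piecewise_eq_of_notMem _ _ _ h, iInf_pos (not_not.1 h)]
  rw [this]
  exact Measurable.piecewise (measurableSet_uncovered k t V) measurable_const measurable_const

/-- Independent starts followed by independent walks are independent pairs of start and walk, so the
mixture of product measures is a product of mixtures. -/
lemma stationaryCoverTime_eq (k : ℕ) :
    stationaryCoverTime (SimpleGraph.cycleGraph (m + 3)) k
      = ∫⁻ ω, coverTime ω ∂Measure.pi fun _ : Fin k => stationaryWalkLaw m := by
  set G := SimpleGraph.cycleGraph (m + 3)
  have hpi : Measure.pi (fun _ : Fin k => stationaryWalkLaw m)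
      = (Measure.pi fun _ : Fin k => stationaryLaw G).bind (multiWalkLaw G) := by
    refine Measure.pi_eq fun s hs => ?_
    rw [Measure.bind_apply (MeasurableSet.univ_pi hs) (Measurable.of_discrete).aemeasurable]
    simp only [multiWalkLaw, Measure.pi_pi]
    rw [lintegral_prod_eq_prod_lintegral_of_indepFun Finset.univ
      (fun i (u : Fin k → Fin (m + 3)) => walkLaw G (u i) (s i))
      (iIndepFun_pi (X := fun i v => walkLaw G v (s i))
        fun i => (Measurable.of_discrete).aemeasurable) fun i => .of_discrete]
    refine Finset.prod_congr rfl fun i _ => ?_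
    rw [stationaryWalkLaw, Measure.bind_apply (hs i) (Measurable.of_discrete).aemeasurable]
    exact (measurePreserving_eval (fun _ : Fin k => stationaryLaw G) i).lintegral_comp
      (f := fun v => walkLaw G v (s i)) .of_discrete
  rw [hpi, Measure.lintegral_bind (Measurable.of_discrete).aemeasurable
    (measurable_coverTime k).aemeasurable]
  rfl

end Cycle

/-! ### Covering an arc of length `j` in time of order `j ^ 2`. -/

section CoverArc

open scoped Fin.CommRing

variable {n : ℕ} [NeZero n]

/-- The vertices `u, u + 1, …, u + r` of the cycle (none if `r < 0`). -/
def arc (u : Fin n) (r : ℤ) : Set (Fin n) := {w | ∃ i : ℕ, (i : ℤ) ≤ r ∧ w = u + (i : Fin n)}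

lemma arc_subset_singleton (u : Fin n) {r : ℤ} (hr : r ≤ 0) : arc u r ⊆ {u} := by
  rintro w ⟨i, hi, rfl⟩
  have : i = 0 := by omega
  simp [this]

lemma arc_eq_univ (u : Fin n) {r : ℤ} (hr : (n : ℤ) ≤ r + 1) : arc u r = Set.univ := by
  refine Set.eq_univ_of_forall fun w => ⟨(w - u).val, ?_, ?_⟩
  · have := (w - u).isLt; omega
  · rw [Fin.cast_val_eq_self]; ring

lemma arc_sub_subset (u : Fin n) {i j : ℕ} (hij : i ≤ j) :
    arc u j ⊆ arc (u - (i : Fin n)) (2 * j) := by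
  rintro w ⟨l, hl, rfl⟩
  exact ⟨i + l, by push_cast; omega, by push_cast; ring⟩

lemma arc_diff_subset_right (u : Fin n) (r : ℤ) : arc u r \ {u} ⊆ arc (u + 1) (r - 1) := by
  rintro w ⟨⟨i, hi, rfl⟩, hne⟩
  obtain _ | i := i
  · simp at hne
  · exact ⟨i, by push_cast at hi; omega, by push_cast; ring⟩

lemma arc_subset_left (u : Fin n) (r : ℤ) : arc u r ⊆ arc (u - 1) (r + 1) := by
  rintro w ⟨i, hi, rfl⟩
  exact ⟨i + 1, by push_cast; omega, by push_cast; ring⟩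

/-- The expectation of the polynomial `-y (α + y) (γ - y) ^ 2` at the position `y` at time `t`
of the lazy walk on `ℤ` started at `x`. -/
def quarticMean (α γ t x : ℝ) : ℝ :=
  -((x ^ 4 + 3 * t * x ^ 2 + (3 * t ^ 2 - t) / 4) + (α - 2 * γ) * (x ^ 3 + 3 / 2 * t * x)
    + (γ ^ 2 - 2 * α * γ) * (x ^ 2 + t / 2) + α * γ ^ 2 * x)

lemma quarticMean_zero (α γ x : ℝ) :
    quarticMean α γ 0 x = -x * (α + x) * (γ - x) ^ 2 := by
  unfold quarticMean; ring

lemma quarticMean_succ (α γ t x : ℝ) :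
    quarticMean α γ (t + 1) x = 1 / 2 * quarticMean α γ t x + 1 / 4 * quarticMean α γ t (x - 1)
      + 1 / 4 * quarticMean α γ t (x + 1) := by
  unfold quarticMean; ring

/-- The walk covers the arc `u, …, u + r` whenever its displacement is at least `r`; the probability
of the latter is bounded from below by the mean of a quartic polynomial. -/
lemma missProb_arc_le_quarticMean {α γ ε : ℝ} (hα : 0 ≤ α) (hε : 0 ≤ ε)
    (hmax : ∀ x : ℝ, x ≤ 0 → ε * (-x * (α + x) * (γ - x) ^ 2) ≤ 1) (t : ℕ) (u : Fin n) (r : ℤ) :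
    missProb t (arc u r) u ≤ 1 - ε * quarticMean α γ t r := by
  induction t generalizing u r with
  | zero =>
    rw [Nat.cast_zero, quarticMean_zero]
    rcases le_or_gt r 0 with hr | hr
    · rw [missProb_of_subset_singleton 0 (arc_subset_singleton u hr)]
      linarith [hmax r (by exact_mod_cast hr)]
    · have hr' : (0 : ℝ) < r := by exact_mod_cast hr
      have : 0 ≤ ε * (r * (α + r) * (γ - r) ^ 2) := by positivity
      linarith [missProb_le_one 0 (arc u r) u]
  | succ t ih =>
    rw [missProb_succ, Nat.cast_succ, quarticMean_succ]
    have h0 := (missProb_mono t (Set.sdiff_subset (s := arc u r) (t := {u})) u).trans (ih u r)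
    have h1 := (missProb_mono t (arc_diff_subset_right u r) (u + 1)).trans (ih (u + 1) (r - 1))
    have h2 := (missProb_mono t ((Set.sdiff_subset (t := {u})).trans (arc_subset_left u r)) (u - 1)).trans
      (ih (u - 1) (r + 1))
    push_cast at h1 h2
    linarith

lemma quartic_le {j x : ℝ} (hx : x ≤ 0) :
    -x * (58 * j + x) * (22 * j - x) ^ 2 ≤ 5382400 * j ^ 4 := by
  rcases le_or_gt (58 * j + x) 0 with h | h
  · have h1 : -x * (58 * j + x) ≤ 0 := mul_nonpos_of_nonneg_of_nonpos (by linarith) h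
    have h2 : -x * (58 * j + x) * (22 * j - x) ^ 2 ≤ 0 :=
      mul_nonpos_of_nonpos_of_nonneg h1 (sq_nonneg _)
    have : 0 ≤ j ^ 4 := by positivity
    linarith
  · have h1 : -x * (58 * j + x) ≤ 841 * j ^ 2 := by nlinarith [sq_nonneg (x + 29 * j)]
    have h2 : (22 * j - x) ^ 2 ≤ (80 * j) ^ 2 :=
      pow_le_pow_left₀ (by linarith) (by linarith) 2
    calc -x * (58 * j + x) * (22 * j - x) ^ 2
        ≤ 841 * j ^ 2 * (80 * j) ^ 2 := by gcongr
      _ = 5382400 * j ^ 4 := by ring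

/-- At time `800 j ^ 2` the lazy walk has standard deviation `20 j`, so a displacement of at least
`2 j` has probability bounded below. -/
lemma missProb_arc_le (j : ℕ) (u : Fin n) :
    missProb (800 * j ^ 2) (arc u (2 * j)) u ≤ 1 - 1 / 25 := by
  rcases Nat.eq_zero_or_pos j with rfl | hj
  · rw [missProb_of_subset_singleton _ (arc_subset_singleton u (by simp))]; norm_num
  · have hj' : (0 : ℝ) < j := by exact_mod_cast hj
    -- The roots are scaled to the standard deviation `20 j`. On `x ≤ 0` the quartic is at most `841
    -- j ^ 2 * (80 j) ^ 2 = 5382400 j ^ 4`, and its mean is `256000 j ^ 4 + 200 j ^ 2`; the ratio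
    -- exceeds `1/25`.
    have h := missProb_arc_le_quarticMean (n := n) (α := 58 * j) (γ := 22 * j)
      (ε := 1 / (5382400 * (j : ℝ) ^ 4)) (by positivity) (by positivity) (fun x hx => by
        rw [div_mul_eq_mul_div, one_mul, div_le_one (by positivity)]
        exact quartic_le hx) (800 * j ^ 2) u (2 * j)
    refine h.trans (sub_le_sub_left ?_ 1)
    have hq : 256000 * (j : ℝ) ^ 4 ≤
        quarticMean (58 * j) (22 * j) ((800 * j ^ 2 : ℕ) : ℝ) ((2 * j : ℤ) : ℝ) := by
      unfold quarticMean; push_cast; nlinarith [sq_nonneg (j : ℝ)]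
    calc (1 / 25 : ℝ) ≤ 1 / (5382400 * (j : ℝ) ^ 4) * (256000 * (j : ℝ) ^ 4) := by
          field_simp; norm_num
      _ ≤ _ := by gcongr

/-- Time `800 j ^ 2` contains `j / n` blocks of length `800 n ^ 2`, each covering the whole cycle
with probability at least `1/25` from any start. -/
lemma missProb_univ_le (j : ℕ) (hj : n ≤ j) (u : Fin n) :
    missProb (800 * j ^ 2) Set.univ u ≤ (1 - 1 / 25) ^ (j / n) := by
  have h : ∀ v : Fin n, missProb (800 * n ^ 2) Set.univ v ≤ 1 - 1 / 25 := fun v => by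
    rw [← arc_eq_univ v (r := 2 * n) (by omega)]; exact missProb_arc_le n v
  refine (missProb_antitone _ u ?_).trans (missProb_mul_le h (j / n) u)
  calc j / n * (800 * n ^ 2) = 800 * (j / n * n * n) := by ring
    _ ≤ 800 * (j * j) := by gcongr; exact Nat.div_mul_le_self j n
    _ = 800 * j ^ 2 := by ring

lemma sum_eq_sum_range_add (v : Fin n) (F : Fin n → ℝ) :
    ∑ u, F u = ∑ i ∈ Finset.range n, F (v + (i : Fin n)) := by
  rw [← Equiv.sum_comp (Equiv.addLeft v) F, ← Fin.sum_univ_eq_sum_range fun i => F (v + (i : Fin n))]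
  simp

lemma sum_eq_sum_range_sub (v : Fin n) (F : Fin n → ℝ) :
    ∑ u, F u = ∑ i ∈ Finset.range n, F (v - (i : Fin n)) := by
  rw [← Equiv.sum_comp (Equiv.subLeft v) F, ← Fin.sum_univ_eq_sum_range fun i => F (v - (i : Fin n))]
  simp

lemma avgMissProb_nonneg (t : ℕ) (W : Set (Fin n)) : 0 ≤ avgMissProb t W :=
  div_nonneg (Finset.sum_nonneg fun u _ => missProb_nonneg t W u) (Nat.cast_nonneg n)

lemma avgMissProb_le {t : ℕ} {W : Set (Fin n)} {β : ℝ} (h : ∀ u, missProb t W u ≤ β) :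
    avgMissProb t W ≤ β := by
  have hn : (0 : ℝ) < n := by exact_mod_cast NeZero.pos n
  rw [avgMissProb, div_le_iff₀ hn]
  calc ∑ u, missProb t W u ≤ ∑ _u : Fin n, β := Finset.sum_le_sum fun u _ => h u
    _ = β * n := by simp [mul_comm]

/-- For `j < n`, the `j + 1` starts `u - i` with `i ≤ j` are good: from each, the arc lies within `2
j` steps to the right. For `j ≥ n`, the decay comes from repeated coverings of the cycle. -/
lemma avgMissProb_arc_le (j : ℕ) (u : Fin n) :
    avgMissProb (800 * j ^ 2) (arc u j) ≤ Real.exp (-(1 / 50 * ((j + 1) / n))) := by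
  have hn : (0 : ℝ) < n := by exact_mod_cast NeZero.pos n
  rcases lt_or_ge j n with hj | hj
  · have hle : ∀ i ∈ Finset.range n, missProb (800 * j ^ 2) (arc u j) (u - (i : Fin n))
        ≤ 1 - if i ≤ j then 1 / 25 else 0 := fun i _ => by
      split_ifs with hi
      · exact (missProb_mono _ (arc_sub_subset u hi) _).trans (missProb_arc_le j _)
      · simpa using missProb_le_one _ _ _
    have hcard : ∑ i ∈ Finset.range n, (if i ≤ j then (1 / 25 : ℝ) else 0) = (j + 1) / 25 := by
      rw [← Finset.sum_filter]
      have : (Finset.range n).filter (· ≤ j) = Finset.range (j + 1) := by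
        ext i; simp; omega
      rw [this, Finset.sum_const, Finset.card_range, nsmul_eq_mul]; push_cast; ring
    have hs : ∑ v, missProb (800 * j ^ 2) (arc u j) v ≤ n - (j + 1) / 25 := by
      rw [sum_eq_sum_range_sub u]
      refine (Finset.sum_le_sum hle).trans ?_
      rw [Finset.sum_sub_distrib, hcard]; simp
    calc avgMissProb (800 * j ^ 2) (arc u j) ≤ (n - (j + 1) / 25) / n := by
          unfold avgMissProb; gcongr
      _ = -(1 / 25 * ((j + 1) / n)) + 1 := by field_simp; ring
      _ ≤ Real.exp (-(1 / 25 * ((j + 1) / n))) := Real.add_one_le_exp _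
      _ ≤ _ := by
        apply Real.exp_le_exp.2
        have : (0 : ℝ) ≤ (j + 1) / n := by positivity
        linarith
  -- Rounding `j / n` down costs a factor of two, hence `1/50` rather than `1/25` in the exponent.
  · have hq : ((j : ℝ) + 1) / n ≤ 2 * ((j / n : ℕ) : ℝ) := by
      rw [div_le_iff₀ hn]
      have h1 : 1 ≤ j / n := (Nat.one_le_div_iff (NeZero.pos n)).2 hj
      have h2 : j + 1 ≤ (j / n + 1) * n := by
        have := Nat.lt_div_mul_add (a := j) (NeZero.pos n); linarith
      have h3 : j + 1 ≤ 2 * (j / n) * n := h2.trans (by gcongr; omega)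
      exact_mod_cast h3
    calc avgMissProb (800 * j ^ 2) (arc u j) ≤ (1 - 1 / 25) ^ (j / n) :=
          avgMissProb_le fun v => (missProb_mono _ (Set.subset_univ _) v).trans
            (missProb_univ_le j hj v)
      _ ≤ Real.exp (-(1 / 25)) ^ (j / n) := by
          refine pow_le_pow_left₀ (by norm_num) ?_ _
          linarith [Real.add_one_le_exp (-(1 / 25) : ℝ)]
      _ = Real.exp ((j / n : ℕ) * (-(1 / 25))) := (Real.exp_nat_mul _ _).symm
      _ ≤ _ := by
        apply Real.exp_le_exp.2; linarith

end CoverArc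

/-! ### Union bound over arcs and summation over time scales. -/

section UpperBound

lemma pi_missEvent {m k : ℕ} (t : ℕ) (W : Set (Fin (m + 3))) :
    (Measure.pi fun _ : Fin k => stationaryWalkLaw m).real (Set.univ.pi fun _ => missEvent t W)
      = avgMissProb t W ^ k := by
  rw [Measure.real, Measure.pi_pi, Finset.prod_const, ENNReal.toReal_pow, ← Measure.real,
    stationaryWalkLaw_missEvent, Finset.card_univ, Fintype.card_fin]

-- An uncovered vertex `v` lies in the block of index `v / (j + 1)`, and that block is then missed
-- in part by every walk. The last block may wrap around, which is harmless.
open scoped Fin.CommRing in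
lemma uncovered_subset_iUnion_arc {m : ℕ} (k t j : ℕ) :
    uncovered (Fin (m + 3)) k t ⊆ ⋃ b ∈ Finset.range ((m + 3) / (j + 1) + 1),
      Set.univ.pi fun _ => missEvent t (arc ((b * (j + 1) : ℕ) : Fin (m + 3)) j) := by
  intro ω hω
  rw [uncovered_eq, Set.mem_iUnion] at hω
  obtain ⟨v, hv⟩ := hω
  refine Set.mem_iUnion₂.2 ⟨v.val / (j + 1), ?_, fun i _ hi => hv i trivial ?_⟩
  · rw [Finset.mem_range, Nat.lt_succ_iff]
    exact Nat.div_le_div_right v.isLt.le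
  · refine Set.singleton_subset_iff.2 (hi ⟨v.val % (j + 1), ?_, ?_⟩)
    · exact_mod_cast Nat.lt_succ_iff.1 (Nat.mod_lt v.val (Nat.succ_pos j))
    · rw [← Nat.cast_add, Nat.div_add_mod', Fin.cast_val_eq_self]

lemma measure_uncovered_le {m : ℕ} (k j : ℕ) :
    (Measure.pi fun _ : Fin k => stationaryWalkLaw m).real
        (uncovered (Fin (m + 3)) k (800 * j ^ 2))
      ≤ ((m + 3 : ℕ) / (j + 1) + 1) * Real.exp (-(1 / 50 * ((j + 1) * (k / (m + 3 : ℕ))))) := by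
  refine (measureReal_mono (uncovered_subset_iUnion_arc k _ j) (measure_ne_top _ _)).trans
    ((measureReal_biUnion_finset_le _ _).trans ?_)
  have h : ∀ b ∈ Finset.range ((m + 3) / (j + 1) + 1),
      (Measure.pi fun _ : Fin k => stationaryWalkLaw m).real (Set.univ.pi fun _ =>
        missEvent (800 * j ^ 2) (arc (n := m + 3) (Fin.ofNat _ (b * (j + 1))) j))
      ≤ Real.exp (-(1 / 50 * ((j + 1) * (k / (m + 3 : ℕ))))) := fun b _ => by
    rw [pi_missEvent]
    refine (pow_le_pow_left₀ (avgMissProb_nonneg _ _) (avgMissProb_arc_le j _) k).trans_eq ?_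
    rw [← Real.exp_nat_mul]
    congr 1; ring
  refine (Finset.sum_le_sum h).trans ?_
  rw [Finset.sum_const, Finset.card_range, nsmul_eq_mul]
  gcongr
  push_cast
  gcongr
  exact_mod_cast Nat.cast_div_le (α := ℝ) (m := m + 3) (n := j + 1)

/-- A summation formula bounding a random time along a deterministic sequence of times. -/
lemma coverTime_le_tsum {V : Type*} {k : ℕ} (ω : Fin k → ℕ → V) {T : ℕ → ℕ} (hT : StrictMono T)
    (M : ℕ) :
    coverTime ω ≤ T M + ∑' i, (uncovered V k (T (M + i))).indicator
      (fun _ => ((T (M + i + 1) - T (M + i) : ℕ) : ℝ≥0∞)) ω := by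
  set f : ℕ → ℝ≥0∞ := fun i => (uncovered V k (T (M + i))).indicator
      (fun _ => ((T (M + i + 1) - T (M + i) : ℕ) : ℝ≥0∞)) ω
  -- Truncating at `T (M + J)` allows an infinite cover time; in that case the partial sums exceed
  -- every bound.
  have hmin : ∀ J, min (coverTime ω) (T (M + J) : ℝ≥0∞) ≤ T M + ∑ i ∈ Finset.range J, f i := by
    intro J
    induction J with
    | zero => simp
    | succ J ih =>
      rw [Finset.sum_range_succ]
      by_cases hω : ω ∈ uncovered V k (T (M + J))
      · have hf : f J = ((T (M + J + 1) - T (M + J) : ℕ) : ℝ≥0∞) := Set.indicator_of_mem hω _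
        have hle : (T (M + J) : ℝ≥0∞) ≤ coverTime ω :=
          (Nat.cast_le.2 (Nat.le_succ _)).trans (le_coverTime hω)
        rw [min_eq_right hle] at ih
        calc min (coverTime ω) (T (M + (J + 1)) : ℝ≥0∞) ≤ (T (M + J + 1) : ℝ≥0∞) := min_le_right _ _
          _ = (T (M + J) : ℝ≥0∞) + f J := by
            rw [hf, ← Nat.cast_add, Nat.add_sub_cancel' (hT.monotone (Nat.le_succ _))]
          _ ≤ _ := by rw [← add_assoc]; gcongr
      · have hle := coverTime_le hω
        rw [min_eq_left hle] at ih
        exact (min_le_left _ _).trans (ih.trans (add_le_add_right le_self_add _))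
  by_contra! hlt
  obtain ⟨N, hN⟩ := ENNReal.exists_nat_gt hlt.ne_top
  have h1 := (hmin N).trans (add_le_add_right (ENNReal.sum_le_tsum _) _)
  rcases min_le_iff.1 h1 with h | h
  · exact absurd hlt (not_lt.2 h)
  · have : (N : ℝ≥0∞) ≤ T (M + N) := by
      exact_mod_cast (Nat.le_add_left N M).trans (hT.id_le _)
    exact absurd (hN.trans_le (this.trans h)) (lt_irrefl _)

/-- The left side equals `1 / (4 sinh (β / 2) ^ 2)`, and `sinh x ≥ x` for `x ≥ 0`. -/
lemma exp_neg_div_sq_le {β : ℝ} (hβ : 0 < β) :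
    Real.exp (-β) / (1 - Real.exp (-β)) ^ 2 ≤ 1 / β ^ 2 := by
  have h1 : β / 2 ≤ Real.sinh (β / 2) := Real.self_le_sinh_iff.2 (by positivity)
  have hx : Real.exp (-β) < 1 := by simpa using hβ
  have h2 : β * Real.exp (-(β / 2)) ≤ 1 - Real.exp (-β) := by
    have e1 : Real.exp (-β) = Real.exp (-(β / 2)) * Real.exp (-(β / 2)) := by
      rw [← Real.exp_add]; congr 1; ring
    have e2 : Real.exp (β / 2) * Real.exp (-(β / 2)) = 1 := by rw [← Real.exp_add]; simp
    rw [Real.sinh_eq] at h1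
    have h3 := mul_le_mul_of_nonneg_right h1 (Real.exp_pos (-(β / 2))).le
    rw [e1]; linarith
  rw [div_le_div_iff₀ (by nlinarith) (by positivity), one_mul]
  calc Real.exp (-β) * β ^ 2 = (β * Real.exp (-(β / 2))) ^ 2 := by
        rw [mul_pow, ← Real.exp_nat_mul, mul_comm]; congr 2; push_cast; ring
    _ ≤ _ := by gcongr

lemma tsum_ofReal_mul_exp_le {β : ℝ} (hβ : 0 < β) (M : ℕ) :
    ∑' i : ℕ, ENNReal.ofReal (((M + i : ℕ) + 1) * Real.exp (-(β * ((M + i : ℕ) + 1))))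
      ≤ ENNReal.ofReal (1 / β ^ 2) := by
  set x := Real.exp (-β)
  have hx : ‖x‖ < 1 := by
    rw [Real.norm_of_nonneg (Real.exp_pos _).le]; exact by simpa using hβ
  have hs := hasSum_coe_mul_geometric_of_norm_lt_one hx
  have he : ∀ j : ℕ, ((j : ℝ) + 1) * Real.exp (-(β * (j + 1))) = (j + 1 : ℕ) * x ^ (j + 1) := by
    intro j
    rw [← Real.exp_nat_mul]; push_cast; congr 2; ring
  simp only [he]
  calc ∑' i : ℕ, ENNReal.ofReal ((M + i + 1 : ℕ) * x ^ (M + i + 1))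
      = ∑' i : ℕ, (fun j : ℕ => ENNReal.ofReal (j * x ^ j)) (i + (M + 1)) := by
        refine tsum_congr fun i => ?_
        rw [show i + (M + 1) = M + i + 1 by ring]
    _ ≤ ∑' j : ℕ, ENNReal.ofReal (j * x ^ j) :=
        ENNReal.tsum_comp_le_tsum_of_injective (add_left_injective (M + 1)) _
    _ = ENNReal.ofReal (x / (1 - x) ^ 2) := by
        rw [← ENNReal.ofReal_tsum_of_nonneg (fun j => by positivity) hs.summable, hs.tsum_eq]
    _ ≤ _ := ENNReal.ofReal_le_ofReal (exp_neg_div_sq_le hβ)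

/-- The exponential is split into two equal factors: one is at most `1 / k` and absorbs the arc
count, at most `2 k`; the other is kept for summation over `j`. -/
lemma uncovered_term_le {n k j : ℕ} (hn : 0 < n) (hk : 2 ≤ k)
    (hj : 100 * ((n : ℝ) / k) * Real.log k ≤ j + 1) :
    (800 * (2 * j + 1)) * (((n : ℝ) / (j + 1) + 1)
        * Real.exp (-(1 / 50 * (((j : ℝ) + 1) * (k / n)))))
      ≤ 3200 * (((j : ℝ) + 1) * Real.exp (-((k : ℝ) / n / 100 * (j + 1)))) := by
  have hn' : (0 : ℝ) < n := by exact_mod_cast hn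
  have hk' : (2 : ℝ) ≤ k := by exact_mod_cast hk
  have hk0 : (0 : ℝ) < k := by linarith
  have hL : Real.log 2 ≤ Real.log k := Real.log_le_log (by norm_num) hk'
  have hL2 := Real.log_two_gt_d9
  have hj' : Real.log k ≤ (k : ℝ) / n / 100 * (j + 1) := by
    calc Real.log k = (k : ℝ) / n / 100 * (100 * ((n : ℝ) / k) * Real.log k) := by
          field_simp
      _ ≤ _ := by gcongr
  have h1 : (n : ℝ) / (j + 1) ≤ k := by
    rw [div_le_iff₀ (by positivity)]
    have : (n : ℝ) = k * (n / k) := by field_simp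
    calc (n : ℝ) = k * (n / k * 1) := by rw [mul_one]; exact this
      _ ≤ k * (100 * ((n : ℝ) / k) * Real.log k) := by
        rw [show 100 * ((n : ℝ) / k) * Real.log k = n / k * (100 * Real.log k) by ring]
        gcongr
        linarith
      _ ≤ _ := by gcongr
  have h2 : Real.exp (-((k : ℝ) / n / 100 * (j + 1))) ≤ 1 / k := by
    rw [one_div, ← Real.exp_log (inv_pos.2 hk0), Real.log_inv]
    exact Real.exp_le_exp.2 (by linarith)
  have h3 : Real.exp (-(1 / 50 * (((j : ℝ) + 1) * (k / n))))
      = Real.exp (-((k : ℝ) / n / 100 * (j + 1))) * Real.exp (-((k : ℝ) / n / 100 * (j + 1))) := by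
    rw [← Real.exp_add]; congr 1; ring
  rw [h3]
  set y := Real.exp (-((k : ℝ) / n / 100 * (j + 1)))
  have hy : 0 < y := Real.exp_pos _
  calc (800 * (2 * (j : ℝ) + 1)) * (((n : ℝ) / (j + 1) + 1) * (y * y))
      ≤ (1600 * ((j : ℝ) + 1)) * ((k + k) * (1 / k * y)) := by
        have : 800 * (2 * (j : ℝ) + 1) ≤ 1600 * (j + 1) := by linarith
        gcongr
        linarith
    _ = 3200 * (((j : ℝ) + 1) * y) := by field_simp; ring

lemma stationaryCoverTime_cycleGraph_le (m k : ℕ) (hk : 2 ≤ k) :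
    stationaryCoverTime (SimpleGraph.cycleGraph (m + 3)) k
      ≤ ENNReal.ofReal (100000000 * ((((m + 3 : ℕ) : ℝ) / k) ^ 2 * Real.log k ^ 2)) := by
  set n := m + 3 with hn
  have hn' : (0 : ℝ) < n := by rw [hn]; positivity
  have hk' : (2 : ℝ) ≤ k := by exact_mod_cast hk
  have hk0 : (0 : ℝ) < k := by linarith
  have hL : Real.log 2 ≤ Real.log k := Real.log_le_log (by norm_num) hk'
  have hL2 := Real.log_two_gt_d9
  set μ := Measure.pi fun _ : Fin k => stationaryWalkLaw m
  set T : ℕ → ℕ := fun j => 800 * j ^ 2 with hTdef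
  have hT : StrictMono T := fun a b hab => by simp only [hTdef]; gcongr
  set x : ℝ := 100 * ((n : ℝ) / k) * Real.log k with hx
  have hx0 : 0 ≤ x := by
    have : 0 ≤ Real.log k := by linarith
    positivity
  set M := ⌊x⌋₊
  have hterm : ∀ i, ∫⁻ ω, (uncovered (Fin n) k (T (M + i))).indicator
      (fun _ => ((T (M + i + 1) - T (M + i) : ℕ) : ℝ≥0∞)) ω ∂μ
      ≤ ENNReal.ofReal 3200 * ENNReal.ofReal
        (((M + i : ℕ) + 1) * Real.exp (-((k : ℝ) / n / 100 * ((M + i : ℕ) + 1)))) := by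
    intro i
    rw [lintegral_indicator_const (measurableSet_uncovered _ _ _), ← ofReal_measureReal,
      ← ENNReal.ofReal_natCast, ← ENNReal.ofReal_mul (by positivity),
      ← ENNReal.ofReal_mul (by positivity)]
    apply ENNReal.ofReal_le_ofReal
    refine le_trans ?_ (uncovered_term_le (by omega) hk ((Nat.lt_floor_add_one x).le.trans ?_))
    · have hd : ((T (M + i + 1) - T (M + i) : ℕ) : ℝ) = 800 * (2 * (M + i : ℕ) + 1) := by
        rw [show T (M + i + 1) - T (M + i) = 800 * (2 * (M + i) + 1) by
          simp only [hTdef]; rw [Nat.sub_eq_iff_eq_add (Nat.mul_le_mul_left _ (Nat.pow_le_pow_left (Nat.le_add_right _ 1) 2))]; ring]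
        push_cast; ring
      rw [hd]
      gcongr
      exact measure_uncovered_le k (M + i)
    · push_cast; linarith [Nat.cast_nonneg (α := ℝ) i]
  rw [stationaryCoverTime_eq]
  calc ∫⁻ ω, coverTime ω ∂μ
      ≤ ∫⁻ ω, (T M + ∑' i, (uncovered (Fin n) k (T (M + i))).indicator
          (fun _ => ((T (M + i + 1) - T (M + i) : ℕ) : ℝ≥0∞)) ω) ∂μ :=
        lintegral_mono fun ω => coverTime_le_tsum ω hT M
    _ = T M + ∑' i, ∫⁻ ω, (uncovered (Fin n) k (T (M + i))).indicator
          (fun _ => ((T (M + i + 1) - T (M + i) : ℕ) : ℝ≥0∞)) ω ∂μ := by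
        rw [lintegral_add_left measurable_const, lintegral_tsum fun i =>
          (measurable_const.indicator (measurableSet_uncovered _ _ _)).aemeasurable]
        rw [lintegral_const, measure_univ, mul_one]
    _ ≤ ENNReal.ofReal (800 * x ^ 2)
        + ENNReal.ofReal 3200 * ENNReal.ofReal (1 / ((k : ℝ) / n / 100) ^ 2) := by
        gcongr
        · rw [← ENNReal.ofReal_natCast]
          apply ENNReal.ofReal_le_ofReal
          simp only [hTdef]; push_cast
          gcongr
          exact Nat.floor_le hx0
        · refine (ENNReal.tsum_le_tsum hterm).trans ?_
          rw [ENNReal.tsum_mul_left]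
          gcongr
          exact tsum_ofReal_mul_exp_le (by positivity) M
    _ ≤ _ := by
        rw [← ENNReal.ofReal_mul (by norm_num), ← ENNReal.ofReal_add (by positivity) (by positivity)]
        apply ENNReal.ofReal_le_ofReal
        -- The tail lacks the factor `log k ^ 2`; as `k ≥ 2`, that factor is at least `0.69 ^ 2`, so
        -- it can be inserted at the cost of a constant.
        have e1 : 1 / ((k : ℝ) / n / 100) ^ 2 = 10000 * ((n : ℝ) / k) ^ 2 := by
          field_simp; norm_num
        have h4 : (0.69 : ℝ) ^ 2 ≤ Real.log k ^ 2 := by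
          apply pow_le_pow_left₀ (by norm_num); linarith
        rw [e1, hx]
        have : 0 ≤ ((n : ℝ) / k) ^ 2 := by positivity
        nlinarith

end UpperBound

/-! ### Exponential barriers for hitting one or two vertices. -/

section HittingBound

/-- A function of the distance `d` along the cycle of length `n` that the transition operator
multiplies by a constant away from `d = 0`. -/
def hitBarrier (n : ℕ) (l d : ℝ) : ℝ := Real.exp (-(l * d)) + Real.exp (-(l * (n - d)))

lemma hitBarrier_nonneg (n : ℕ) (l d : ℝ) : 0 ≤ hitBarrier n l d := by
  unfold hitBarrier; positivity

lemma hitBarrier_average (n : ℕ) (l d : ℝ) :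
    1 / 2 * hitBarrier n l d + 1 / 4 * hitBarrier n l (d + 1) + 1 / 4 * hitBarrier n l (d - 1)
      = (1 + Real.cosh l) / 2 * hitBarrier n l d := by
  unfold hitBarrier
  have h1 : -(l * (d + 1)) = -(l * d) + -l := by ring
  have h2 : -(l * (d - 1)) = -(l * d) + l := by ring
  have h3 : -(l * (n - (d + 1))) = -(l * (n - d)) + l := by ring
  have h4 : -(l * (n - (d - 1))) = -(l * (n - d)) + -l := by ring
  rw [h1, h2, h3, h4, Real.cosh_eq]
  simp only [Real.exp_add]
  ring

lemma hitBarrier_le {n : ℕ} {l d D : ℝ} (hl : 0 ≤ l) (h1 : D ≤ d) (h2 : d ≤ n - D) :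
    hitBarrier n l d ≤ 2 * Real.exp (-(l * D)) := by
  unfold hitBarrier
  have e1 : Real.exp (-(l * d)) ≤ Real.exp (-(l * D)) := by gcongr
  have e2 : Real.exp (-(l * (n - d))) ≤ Real.exp (-(l * D)) := by gcongr; linarith
  linarith

lemma sum_exp_neg_le {l : ℝ} (hl : 0 < l) (n : ℕ) :
    ∑ i ∈ Finset.range n, Real.exp (-(l * i)) ≤ 1 + 1 / l := by
  set x := Real.exp (-l)
  have hx0 : 0 < x := Real.exp_pos _
  have hx : x * (1 + l) ≤ 1 := by
    have h : x * Real.exp l = 1 := by rw [← Real.exp_add]; simp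
    nlinarith [Real.add_one_le_exp l]
  have he : ∀ i : ℕ, Real.exp (-(l * i)) = x ^ i := fun i => by
    rw [← Real.exp_nat_mul]; congr 1; ring
  simp only [he]
  have hg := geom_sum_mul_neg x n
  have hx1 : 0 < 1 - x := by nlinarith
  have h1 : ∑ i ∈ Finset.range n, x ^ i ≤ 1 / (1 - x) := by
    rw [le_div_iff₀ hx1, hg]; linarith [pow_pos hx0 n]
  refine h1.trans ?_
  rw [div_le_iff₀ hx1]
  have : (1 + 1 / l) * (1 - x) - 1 = (1 - x * (1 + l)) / l := by field_simp; ring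
  have h2 : 0 ≤ (1 - x * (1 + l)) / l := div_nonneg (by linarith) hl.le
  linarith

lemma sum_hitBarrier_le {l : ℝ} (hl : 0 < l) (n : ℕ) :
    ∑ i ∈ Finset.range n, hitBarrier n l i ≤ 2 * (1 + 1 / l) := by
  unfold hitBarrier
  rw [Finset.sum_add_distrib, two_mul]
  refine add_le_add (sum_exp_neg_le hl n) (le_trans ?_ (sum_exp_neg_le hl n))
  rw [← Finset.sum_range_reflect (fun i : ℕ => Real.exp (-(l * i))) n]
  refine Finset.sum_le_sum fun i hi => Real.exp_le_exp.2 ?_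
  have h : (((n - 1 - i : ℕ) : ℝ)) ≤ n - i := by
    have hi' := Finset.mem_range.1 hi
    rw [← Nat.cast_sub hi'.le]
    exact_mod_cast (by omega : n - 1 - i ≤ n - i)
  nlinarith

open scoped Fin.CommRing

variable {n : ℕ} [NeZero n]

lemma add_natCast_ne_self (v : Fin n) {d : ℕ} (h0 : 0 < d) (hd : d < n) :
    v + (d : Fin n) ≠ v := by
  intro h
  have h1 : (d : Fin n) = 0 := by simpa using h
  have := Nat.le_of_dvd h0 ((Fin.natCast_eq_zero).1 h1)
  omega

/-- The barrier is at least `1` at the target (`d = 0` or `d = n`) and is an eigenfunction elsewhere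
with eigenvalue at least `1`, so induction on `t` dominates the hitting probability. -/
lemma one_sub_missProb_singleton_le (l : ℝ) (t : ℕ) (v : Fin n) {d : ℕ} (hd : d ≤ n) :
    1 - missProb t {v} (v + (d : Fin n)) ≤ ((1 + Real.cosh l) / 2) ^ t * hitBarrier n l d := by
  have hφ : 1 ≤ (1 + Real.cosh l) / 2 := by linarith [Real.one_le_cosh l]
  induction t generalizing d with
  | zero =>
    by_cases h : 0 < d ∧ d < n
    · rw [missProb_zero_of_not_subset (by simpa using (add_natCast_ne_self v h.1 h.2).symm)]
      simpa using hitBarrier_nonneg n l d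
    · have hb : 1 ≤ hitBarrier n l d := by
        unfold hitBarrier
        rcases (by omega : d = 0 ∨ d = n) with rfl | rfl
        · simpa using (Real.exp_pos _).le
        · simpa using (Real.exp_pos _).le
      linarith [missProb_nonneg 0 {v} (v + (d : Fin n))]
  | succ t ih =>
    by_cases h : 0 < d ∧ d < n
    · obtain ⟨e, rfl⟩ : ∃ e, d = e + 1 := ⟨d - 1, by omega⟩
      have hs : ({v} : Set (Fin n)) \ {v + ((e + 1 : ℕ) : Fin n)} = {v} :=
        sdiff_eq_left.2 (by simpa using (add_natCast_ne_self v h.1 h.2).symm)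
      have h0 := ih hd
      have h1 := ih (d := e + 2) (by omega)
      have h2 := ih (d := e) (by omega)
      rw [missProb_succ, hs,
        show v + ((e + 1 : ℕ) : Fin n) + 1 = v + ((e + 2 : ℕ) : Fin n) by push_cast; ring,
        show v + ((e + 1 : ℕ) : Fin n) - 1 = v + (e : Fin n) by push_cast; ring, pow_succ,
        mul_assoc, ← hitBarrier_average]
      have e1 : ((e + 1 : ℕ) : ℝ) + 1 = ((e + 2 : ℕ) : ℝ) := by push_cast; ring
      have e2 : ((e + 1 : ℕ) : ℝ) - 1 = (e : ℝ) := by push_cast; ring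
      rw [e1, e2]
      linarith
    · have hb : 1 ≤ hitBarrier n l d := by
        unfold hitBarrier
        rcases (by omega : d = 0 ∨ d = n) with rfl | rfl
        · simpa using (Real.exp_pos _).le
        · simpa using (Real.exp_pos _).le
      have := one_le_mul_of_one_le_of_one_le (one_le_pow₀ hφ (n := t + 1)) hb
      linarith [missProb_nonneg (t + 1) {v} (v + (d : Fin n))]

/-- To visit both vertices, the walk must travel from whichever it meets first to the other in the
remaining time. -/
lemma one_sub_missProb_pair_le {v w : Fin n} (hvw : v ≠ w) {K : ℝ} (t : ℕ)
    (h1 : 1 - missProb t {v} w ≤ K) (h2 : 1 - missProb t {w} v ≤ K) (u : Fin n) :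
    1 - missProb t {v, w} u ≤ K := by
  induction t generalizing u with
  | zero =>
    have : ¬ ({v, w} : Set (Fin n)) ⊆ {u} := fun h => by
      have hv : v = u := h (by simp)
      have hw : w = u := h (by simp)
      exact hvw (hv.trans hw.symm)
    rw [missProb_zero_of_not_subset this]
    linarith [missProb_le_one 0 {v} w]
  | succ t ih =>
    have ih := ih (by linarith [missProb_succ_le t {v} w]) (by linarith [missProb_succ_le t {w} v])
    by_cases huv : u = v
    · subst huv
      have e : ({u, w} : Set (Fin n)) \ {u} = {w} \ {u} := by ext; simp
      rw [missProb_succ, e, ← missProb_succ]; exact h2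
    by_cases huw : u = w
    · subst huw
      have e : ({v, u} : Set (Fin n)) \ {u} = {v} \ {u} := by ext; simp; grind
      rw [missProb_succ, e, ← missProb_succ]; exact h1
    have e : ({v, w} : Set (Fin n)) \ {u} = {v, w} := sdiff_eq_left.2 (by simp; grind)
    rw [missProb_succ, e]
    linarith [ih u, ih (u + 1), ih (u - 1)]

/-- With rate `l = 1 / s`, the eigenvalue is at most `exp (1 / (2 s ^ 2))`, so its growth over `s ^
2` steps stays bounded. -/
lemma lazy_mgf_pow_le {s : ℝ} (hs : 0 < s) {t : ℕ} (ht : (t : ℝ) ≤ s ^ 2) :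
    ((1 + Real.cosh (1 / s)) / 2) ^ t ≤ 3 := by
  have h1 : (1 + Real.cosh (1 / s)) / 2 ≤ Real.exp ((1 / s) ^ 2 / 2) := by
    linarith [Real.one_le_cosh (1 / s), Real.cosh_le_exp_half_sq (1 / s)]
  calc ((1 + Real.cosh (1 / s)) / 2) ^ t ≤ Real.exp ((1 / s) ^ 2 / 2) ^ t := by
        have := Real.one_le_cosh (1 / s)
        gcongr
    _ = Real.exp (t * ((1 / s) ^ 2 / 2)) := (Real.exp_nat_mul _ _).symm
    _ ≤ Real.exp 1 := by
        gcongr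
        calc t * ((1 / s) ^ 2 / 2) ≤ s ^ 2 * ((1 / s) ^ 2 / 2) := by gcongr
          _ = 1 / 2 := by field_simp
          _ ≤ 1 := by norm_num
    _ ≤ 3 := by linarith [Real.exp_one_lt_d9]

lemma one_sub_avgMissProb_singleton_le {s : ℝ} (hs : 1 ≤ s) {t : ℕ} (ht : (t : ℝ) ≤ s ^ 2)
    (v : Fin n) : 1 - avgMissProb t {v} ≤ 12 * s / n := by
  have hn : (0 : ℝ) < n := by exact_mod_cast NeZero.pos n
  have hs0 : 0 < s := by linarith
  have hsum : n - ∑ u, missProb t {v} u ≤ 12 * s := by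
    calc n - ∑ u, missProb t {v} u
        = ∑ i ∈ Finset.range n, (1 - missProb t {v} (v + (i : Fin n))) := by
          rw [sum_eq_sum_range_add v, Finset.sum_sub_distrib]; simp
      _ ≤ ∑ i ∈ Finset.range n, 3 * hitBarrier n (1 / s) i := by
          refine Finset.sum_le_sum fun i hi =>
            (one_sub_missProb_singleton_le (1 / s) t v (Finset.mem_range.1 hi).le).trans ?_
          exact mul_le_mul_of_nonneg_right (lazy_mgf_pow_le hs0 ht) (hitBarrier_nonneg _ _ _)
      _ ≤ 3 * (2 * (1 + 1 / (1 / s))) := by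
          rw [← Finset.mul_sum]
          gcongr
          exact sum_hitBarrier_le (by positivity) n
      _ ≤ 12 * s := by rw [one_div_one_div]; linarith
  rw [avgMissProb, ← div_self hn.ne', ← sub_div]
  gcongr

lemma one_sub_avgMissProb_pair_le {s : ℝ} (hs : 0 < s) {t D d : ℕ} (ht : (t : ℝ) ≤ s ^ 2)
    (hD : 0 < D) (h1 : D ≤ d) (h2 : d + D ≤ n) (v : Fin n) :
    1 - avgMissProb t {v, v + (d : Fin n)} ≤ 6 * Real.exp (-(D / s)) := by
  have key : ∀ (w : Fin n) (e : ℕ), D ≤ e → e + D ≤ n →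
      1 - missProb t {w} (w + (e : Fin n)) ≤ 6 * Real.exp (-(D / s)) := by
    intro w e he1 he2
    refine (one_sub_missProb_singleton_le (1 / s) t w (by omega)).trans ?_
    have hb : hitBarrier n (1 / s) e ≤ 2 * Real.exp (-(1 / s * D)) :=
      hitBarrier_le (by positivity) (by exact_mod_cast he1)
        (by rw [le_sub_iff_add_le]; exact_mod_cast he2)
    calc _ ≤ 3 * (2 * Real.exp (-(1 / s * D))) :=
          mul_le_mul (lazy_mgf_pow_le hs ht) hb (hitBarrier_nonneg _ _ _) (by norm_num)
      _ = _ := by rw [one_div_mul_eq_div]; ring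
  have hvw : v ≠ v + (d : Fin n) := (add_natCast_ne_self v (by omega) (by omega)).symm
  have hback : v + (d : Fin n) + ((n - d : ℕ) : Fin n) = v := by
    rw [add_assoc, ← Nat.cast_add, Nat.add_sub_cancel' (by omega)]; simp
  have hk2 := key (v + (d : Fin n)) (n - d) (by omega) (by omega)
  rw [hback] at hk2
  have h : ∀ u, 1 - 6 * Real.exp (-(D / s)) ≤ missProb t {v, v + (d : Fin n)} u := fun u => by
    linarith [one_sub_missProb_pair_le hvw t (key v d h1 h2) hk2 u]
  have hn : (0 : ℝ) < n := by exact_mod_cast NeZero.pos n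
  have : 1 - 6 * Real.exp (-(D / s)) ≤ avgMissProb t {v, v + (d : Fin n)} := by
    rw [avgMissProb, le_div_iff₀ hn]
    calc (1 - 6 * Real.exp (-(D / s))) * n = ∑ _u : Fin n, (1 - 6 * Real.exp (-(D / s))) := by
          rw [Finset.sum_const, Finset.card_univ, Fintype.card_fin, nsmul_eq_mul, mul_comm]
      _ ≤ _ := Finset.sum_le_sum fun u _ => h u
  linarith

end HittingBound

/-! ### Second moment method for spaced vertices. -/

section LowerBound

/-- The second moment method: a lower bound for the probability of a union of events. -/
lemma second_moment_le_measureReal_iUnion {Ω : Type*} [MeasurableSpace Ω] (μ : Measure Ω)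
    [IsFiniteMeasure μ] {ι : Type*} [Fintype ι] {E : ι → Set Ω}
    (hE : ∀ j, MeasurableSet (E j)) (θ : ℝ) :
    2 * θ * ∑ j, μ.real (E j) - θ ^ 2 * ∑ j, ∑ l, μ.real (E j ∩ E l) ≤ μ.real (⋃ j, E j) := by
  have hint : ∀ {A : Set Ω}, MeasurableSet A → Integrable (A.indicator (1 : Ω → ℝ)) μ :=
    fun hA => (integrable_const (1 : ℝ)).indicator hA
  have h1 : Integrable (fun ω => ∑ j, (E j).indicator (1 : Ω → ℝ) ω) μ :=
    integrable_finsetSum _ fun j _ => hint (hE j)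
  have h2 : Integrable (fun ω => ∑ j, ∑ l, (E j ∩ E l).indicator (1 : Ω → ℝ) ω) μ :=
    integrable_finsetSum _ fun j _ => integrable_finsetSum _ fun l _ =>
      hint ((hE j).inter (hE l))
  have e1 : ∫ ω, ∑ j, (E j).indicator (1 : Ω → ℝ) ω ∂μ = ∑ j, μ.real (E j) := by
    rw [integral_finsetSum _ fun j _ => hint (hE j)]
    exact Finset.sum_congr rfl fun j _ => integral_indicator_one (hE j)
  have e2 : ∫ ω, ∑ j, ∑ l, (E j ∩ E l).indicator (1 : Ω → ℝ) ω ∂μ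
      = ∑ j, ∑ l, μ.real (E j ∩ E l) := by
    rw [integral_finsetSum _ fun j _ => integrable_finsetSum _ fun l _ =>
      hint ((hE j).inter (hE l))]
    refine Finset.sum_congr rfl fun j _ => ?_
    rw [integral_finsetSum _ fun l _ => hint ((hE j).inter (hE l))]
    exact Finset.sum_congr rfl fun l _ => integral_indicator_one ((hE j).inter (hE l))
  rw [← e1, ← e2, ← integral_const_mul, ← integral_const_mul,
    ← integral_sub (h1.const_mul _) (h2.const_mul _),
    ← integral_indicator_one (MeasurableSet.iUnion hE)]
  refine integral_mono ((h1.const_mul _).sub (h2.const_mul _)) (hint (MeasurableSet.iUnion hE))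
    fun ω => ?_
  have hsq : ∑ j, ∑ l, (E j ∩ E l).indicator (1 : Ω → ℝ) ω
      = (∑ j, (E j).indicator (1 : Ω → ℝ) ω) ^ 2 := by
    rw [sq, Finset.sum_mul_sum]
    exact Finset.sum_congr rfl fun j _ => Finset.sum_congr rfl fun l _ => by
      rw [Set.inter_indicator_one]; rfl
  simp only [hsq]
  by_cases hω : ω ∈ ⋃ j, E j
  · rw [Set.indicator_of_mem hω, Pi.one_apply]
    -- With `N` the number of events that occur, `2 θ N - θ ^ 2 N ^ 2 = 1 - (1 - θ N) ^ 2 ≤ 1`.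
    nlinarith [sq_nonneg (1 - θ * ∑ j, (E j).indicator (1 : Ω → ℝ) ω)]
  · rw [Set.indicator_of_notMem hω]
    have h0 : ∑ j, (E j).indicator (1 : Ω → ℝ) ω = 0 :=
      Finset.sum_eq_zero fun j _ => Set.indicator_of_notMem
        (fun h => hω (Set.mem_iUnion.2 ⟨j, h⟩)) _
    simp [h0]

/-- Since `a b ≥ 1/4`, the additive error `δ` becomes a factor `1 + 4 δ ≤ exp (4 δ)`, whose `k`-th
power is at most `2`. -/
lemma pair_pow_le {a b c δ : ℝ} {k : ℕ} (ha : 1 / 2 ≤ a) (hb : 1 / 2 ≤ b) (hc : 0 ≤ c)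
    (hδ : 0 ≤ δ) (h : c ≤ a * b + δ) (hk : 4 * k * δ ≤ Real.log 2) :
    c ^ k ≤ 2 * (a ^ k * b ^ k) := by
  have h1 : c ≤ a * b * Real.exp (4 * δ) := by
    have hab : 1 / 4 ≤ a * b := by nlinarith
    have := Real.add_one_le_exp (4 * δ)
    nlinarith
  have h2 : Real.exp (4 * δ) ^ k ≤ 2 := by
    rw [← Real.exp_nat_mul, ← Real.exp_log (two_pos (α := ℝ))]
    exact Real.exp_le_exp.2 (by linarith)
  calc c ^ k ≤ (a * b * Real.exp (4 * δ)) ^ k := by gcongr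
    _ = Real.exp (4 * δ) ^ k * (a ^ k * b ^ k) := by rw [mul_pow, mul_pow]; ring
    _ ≤ _ := by gcongr

lemma missEvent_union {V : Type*} (t : ℕ) (W W' : Set V) :
    missEvent t W ∪ missEvent t W' = missEvent t (W ∪ W') := by
  ext ω
  simp only [missEvent, Set.mem_union, Set.mem_ofPred_eq, Set.union_subset_iff]
  tauto

/-- If the expected number of uncovered vertices among `v j` is not too small, and it is unlikely
that one walk visits two of them, then an uncovered vertex exists with positive probability. -/
lemma measure_uncovered_ge {m k t : ℕ} {ι : Type*} [Fintype ι] (v : ι → Fin (m + 3)) {δ : ℝ}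
    (hδ : 0 ≤ δ) (hk : 4 * k * δ ≤ Real.log 2)
    (hb : ∀ j, 1 / 2 ≤ avgMissProb t {v j})
    (hp : ∀ j l, j ≠ l → 1 - avgMissProb t {v j, v l} ≤ δ)
    (hm : 1 / 4 ≤ ∑ j, avgMissProb t {v j} ^ k) :
    1 / 6 ≤ (Measure.pi fun _ : Fin k => stationaryWalkLaw m).real
      (uncovered (Fin (m + 3)) k t) := by
  classical
  set μ := Measure.pi fun _ : Fin k => stationaryWalkLaw m
  set E : ι → Set (Fin k → ℕ → Fin (m + 3)) := fun j => Set.univ.pi fun _ => missEvent t {v j}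
  set M := ∑ j, avgMissProb t {v j} ^ k with hM
  have hE : ∀ j, MeasurableSet (E j) := fun j =>
    MeasurableSet.univ_pi fun _ => measurableSet_missEvent _ _
  have hμ : ∀ j, μ.real (E j) = avgMissProb t {v j} ^ k := fun j => pi_missEvent _ _
  have hpair : ∀ j l, μ.real (E j ∩ E l) ≤ (if j = l then avgMissProb t {v j} ^ k else 0)
      + 2 * (avgMissProb t {v j} ^ k * avgMissProb t {v l} ^ k) := by
    intro j l
    have h0 : ∀ i, 0 ≤ avgMissProb t {v i} ^ k := fun i =>
      pow_nonneg (by linarith [hb i]) k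
    split_ifs with hjl
    · subst hjl
      rw [Set.inter_self, hμ]
      linarith [mul_nonneg (h0 j) (h0 j)]
    · rw [zero_add]
      have hinter : μ.real (E j ∩ E l)
          = (stationaryWalkLaw m).real (missEvent t {v j} ∩ missEvent t {v l}) ^ k := by
        simp only [E, ← Set.pi_inter_distrib]
        rw [Measure.real, Measure.pi_pi, Finset.prod_const, ENNReal.toReal_pow, ← Measure.real,
          Finset.card_univ, Fintype.card_fin]
      rw [hinter]
      refine pair_pow_le (hb j) (hb l) measureReal_nonneg hδ ?_ hk
      have hu := measureReal_union_add_inter (μ := stationaryWalkLaw m)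
        (s := missEvent t {v j}) (measurableSet_missEvent t {v l})
      rw [missEvent_union, Set.singleton_union, stationaryWalkLaw_missEvent,
        stationaryWalkLaw_missEvent, stationaryWalkLaw_missEvent] at hu
      have hle : ∀ i, avgMissProb t {v i} ≤ 1 := fun i =>
        avgMissProb_le fun u => missProb_le_one _ _ _
      -- Inclusion–exclusion for one walk: with `a`, `b` the two miss probabilities, both are missed
      -- with probability at most `a + b - 1 + δ`, and `a + b - 1 = a b - (1 - a) (1 - b) ≤ a b`.
      nlinarith [hp j l hjl, mul_nonneg (sub_nonneg.2 (hle j)) (sub_nonneg.2 (hle l))]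
  have hsum : ∑ j, ∑ l, μ.real (E j ∩ E l) ≤ M + 2 * M ^ 2 := by
    refine (Finset.sum_le_sum fun j _ => Finset.sum_le_sum fun l _ => hpair j l).trans_eq ?_
    simp only [Finset.sum_add_distrib, Finset.sum_ite_eq, Finset.mem_univ, if_true,
      ← Finset.mul_sum, ← Finset.sum_mul]
    rw [sq]
  -- This `θ` optimises the bound for second moment `M + 2 M ^ 2`, giving `M / (1 + 2 M)`, which is
  -- `1/6` at `M = 1/4`.
  have h2 := second_moment_le_measureReal_iUnion μ hE (1 / (1 + 2 * M))
  rw [Finset.sum_congr rfl fun j _ => hμ j, ← hM] at h2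
  have hsub : ⋃ j, E j ⊆ uncovered (Fin (m + 3)) k t := by
    rw [uncovered_eq]
    exact Set.iUnion_subset fun j => Set.subset_iUnion
      (fun w => Set.univ.pi fun _ : Fin k => missEvent t {w}) (v j)
  refine le_trans ?_ (h2.trans (measureReal_mono hsub (measure_ne_top _ _)))
  have hpos : 0 < 1 + 2 * M := by linarith
  calc (1 / 6 : ℝ) ≤ M / (1 + 2 * M) := by rw [div_le_div_iff₀ (by norm_num) hpos]; linarith
    _ = 2 * (1 / (1 + 2 * M)) * M - (1 / (1 + 2 * M)) ^ 2 * (M + 2 * M ^ 2) := by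
        field_simp; ring
    _ ≤ _ := by gcongr

lemma le_stationaryCoverTime {m k t : ℕ} {p : ℝ}
    (h : p ≤ (Measure.pi fun _ : Fin k => stationaryWalkLaw m).real
      (uncovered (Fin (m + 3)) k t)) :
    ENNReal.ofReal ((t + 1) * p) ≤ stationaryCoverTime (SimpleGraph.cycleGraph (m + 3)) k := by
  rw [stationaryCoverTime_eq, ENNReal.ofReal_mul (by positivity)]
  calc ENNReal.ofReal (t + 1) * ENNReal.ofReal p
      ≤ ((t + 1 : ℕ) : ℝ≥0∞) * (Measure.pi fun _ : Fin k => stationaryWalkLaw m)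
          (uncovered (Fin (m + 3)) k t) := by
        rw [← ENNReal.ofReal_natCast, ← ofReal_measureReal]
        push_cast
        gcongr
    _ = ∫⁻ ω, (uncovered (Fin (m + 3)) k t).indicator (fun _ => ((t + 1 : ℕ) : ℝ≥0∞)) ω
          ∂(Measure.pi fun _ : Fin k => stationaryWalkLaw m) := by
        rw [lintegral_indicator_const (measurableSet_uncovered _ _ _)]
    _ ≤ _ := by
        refine lintegral_mono fun ω => ?_
        by_cases hω : ω ∈ uncovered (Fin (m + 3)) k t
        · rw [Set.indicator_of_mem hω]; exact le_coverTime hω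
        · rw [Set.indicator_of_notMem hω]; exact zero_le

lemma avgMissProb_zero_singleton {n : ℕ} [NeZero n] (v : Fin n) :
    avgMissProb 0 {v} = 1 - 1 / n := by
  have hn : (0 : ℝ) < n := by exact_mod_cast NeZero.pos n
  have h : ∀ u, missProb 0 {v} u = 1 - if v = u then 1 else 0 := fun u => by
    unfold missProb
    by_cases h : v = u <;> simp [h]
  simp only [avgMissProb, h]
  rw [Finset.sum_sub_distrib, Finset.sum_ite_eq]
  simp
  field_simp

lemma avgMissProb_zero_pair {n : ℕ} [NeZero n] {v w : Fin n} (hvw : v ≠ w) :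
    avgMissProb 0 {v, w} = 1 := by
  have hn : (0 : ℝ) < n := by exact_mod_cast NeZero.pos n
  have h : ∀ u, missProb 0 {v, w} u = 1 := fun u => by
    refine missProb_zero_of_not_subset fun h => hvw ?_
    have hv : v = u := h (by simp)
    have hw : w = u := h (by simp)
    exact hv.trans hw.symm
  simp [avgMissProb, h, hn.ne']

/-- At time zero: with `k ≤ n log n` start vertices, some vertex is missed with positive
probability. -/
lemma measure_uncovered_zero_ge {m k : ℕ} (hk : (k : ℝ) ≤ (m + 3 : ℕ) * Real.log (m + 3 : ℕ)) :
    1 / 6 ≤ (Measure.pi fun _ : Fin k => stationaryWalkLaw m).real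
      (uncovered (Fin (m + 3)) k 0) := by
  set n := m + 3 with hn
  have hn3 : (3 : ℝ) ≤ n := by rw [hn]; push_cast; linarith [Nat.cast_nonneg (α := ℝ) m]
  have hlog2 : 0 ≤ Real.log 2 := Real.log_nonneg (by norm_num)
  refine measure_uncovered_ge (ι := Fin n) id le_rfl (by simpa using hlog2)
    (fun j => ?_) (fun j l hjl => ?_) ?_
  · rw [id, avgMissProb_zero_singleton]
    have : 1 / (n : ℝ) ≤ 1 / 3 := by gcongr
    linarith
  · rw [id, id, avgMissProb_zero_pair hjl]; simp
  · simp only [id, avgMissProb_zero_singleton]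
    rw [Finset.sum_const, Finset.card_univ, Fintype.card_fin, nsmul_eq_mul]
    have hn1 : (0 : ℝ) < n - 1 := by linarith
    have hn0 : (0 : ℝ) < n := by linarith
    have h1 : Real.exp (-(1 / ((n : ℝ) - 1))) ≤ 1 - 1 / n := by
      rw [Real.exp_neg]
      have e : (1 - 1 / (n : ℝ)) = (1 / ((n : ℝ) - 1) + 1)⁻¹ := by
        field_simp; ring
      rw [e]
      gcongr
      exact Real.add_one_le_exp _
    -- Here `n log n / (n - 1) = log n + log n / (n - 1)`, and `log n ≤ n - 1`.
    have h2 : k * (1 / ((n : ℝ) - 1)) ≤ Real.log n + 1 := by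
      rw [mul_one_div, div_le_iff₀ hn1]
      have := Real.log_le_sub_one_of_pos hn0
      nlinarith
    calc (1 / 4 : ℝ) ≤ Real.exp (-1) := by
          rw [Real.exp_neg, one_div]
          gcongr
          linarith [Real.exp_one_lt_d9]
      _ = n * Real.exp (-(Real.log n + 1)) := by
          rw [neg_add, Real.exp_add, Real.exp_neg (Real.log n), Real.exp_log hn0]; field_simp
      _ ≤ n * Real.exp (k * -(1 / ((n : ℝ) - 1))) := by
          gcongr; linarith
      _ = n * Real.exp (-(1 / ((n : ℝ) - 1))) ^ k := by rw [Real.exp_nat_mul]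
      _ ≤ _ := by gcongr

lemma exp_neg_two_mul_le {x : ℝ} (h0 : 0 ≤ x) (h1 : x ≤ 1 / 2) : Real.exp (-(2 * x)) ≤ 1 - x := by
  rw [Real.exp_neg]
  refine inv_le_of_inv_le₀ (by linarith) (le_trans ?_ (Real.add_one_le_exp (2 * x)))
  rw [inv_le_iff_one_le_mul₀ (by linarith)]
  nlinarith

/-- With `y = k ^ (1/4)`, the bounds `D ≤ 9 s log k` and `log k ≤ 4 y` give a real quotient of at
least `2 y ^ 2`; rounding down still leaves `y ^ 2 = √k`. -/
lemma card_spaced_ge {n D : ℕ} {k s : ℝ} (hk : 2 ≤ k) (hs : 1 ≤ s)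
    (hn : (n : ℝ) = 288 * s * k / Real.log k)
    (hD : (D : ℝ) < 7 * s * Real.log k + 1) (hD0 : 0 < D) :
    Real.exp (Real.log k / 4) ^ 2 ≤ (n / D : ℕ) := by
  have hL : Real.log 2 ≤ Real.log k := Real.log_le_log (by norm_num) hk
  have hL2 := Real.log_two_gt_d9
  set L := Real.log k with hLdef
  set y := Real.exp (L / 4) with hy
  have hL0 : 0 < L := by linarith
  have hy1 : L / 4 + 1 ≤ y := Real.add_one_le_exp _
  have hky : k = y ^ 4 := by
    rw [hy, ← Real.exp_nat_mul, ← Real.exp_log (show 0 < k by linarith), ← hLdef]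
    congr 1; push_cast; ring
  have hD' : (D : ℝ) ≤ 9 * s * L := by nlinarith
  have hD0' : (0 : ℝ) < D := by exact_mod_cast hD0
  have hq : (n : ℝ) < ((n / D : ℕ) + 1) * D := by
    exact_mod_cast Nat.lt_mul_of_div_lt (Nat.lt_succ_self _) hD0
  have h1 : 2 * y ^ 2 * (9 * s * L) ≤ n := by
    rw [hn, le_div_iff₀ hL0, hky]
    have h2 : L ^ 2 ≤ 16 * y ^ 2 := by nlinarith
    calc 2 * y ^ 2 * (9 * s * L) * L = 18 * s * y ^ 2 * L ^ 2 := by ring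
      _ ≤ 18 * s * y ^ 2 * (16 * y ^ 2) := by gcongr
      _ = 288 * s * y ^ 4 := by ring
  have h3 : 2 * y ^ 2 * D < ((n / D : ℕ) + 1) * D := by
    refine lt_of_le_of_lt ?_ hq
    exact le_trans (by gcongr) h1
  have h4 := lt_of_mul_lt_mul_right h3 hD0'.le
  nlinarith

open scoped Fin.CommRing in
lemma measure_uncovered_floor_ge {m k : ℕ} (hk : 2 ≤ k) {s : ℝ} (hs : 1 ≤ s)
    (hn : ((m + 3 : ℕ) : ℝ) = 288 * s * k / Real.log k) :
    1 / 6 ≤ (Measure.pi fun _ : Fin k => stationaryWalkLaw m).real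
      (uncovered (Fin (m + 3)) k ⌊s ^ 2⌋₊) := by
  set n := m + 3
  have hk' : (2 : ℝ) ≤ k := by exact_mod_cast hk
  have hk0 : (0 : ℝ) < k := by linarith
  have hL : Real.log 2 ≤ Real.log k := Real.log_le_log (by norm_num) hk'
  have hL2 := Real.log_two_gt_d9
  have hLk : Real.log k ≤ k := Real.log_le_self hk0.le
  set L := Real.log k with hLdef
  have hL0 : 0 < L := by linarith
  have hs0 : 0 < s := by linarith
  have ht : ((⌊s ^ 2⌋₊ : ℕ) : ℝ) ≤ s ^ 2 := Nat.floor_le (by positivity)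
  -- This spacing gives a pair error `δ = 6 k ^ (-7)`, and `4 k δ = 24 k ^ (-6) ≤ 24 / 64 < log 2`.
  set D := ⌈7 * s * L⌉₊ with hDdef
  have hD0 : 0 < D := Nat.ceil_pos.2 (by positivity)
  have hDle : 7 * s * L ≤ D := Nat.le_ceil _
  have hDlt : (D : ℝ) < 7 * s * L + 1 := Nat.ceil_lt_add_one (by positivity)
  have hN : n / D * D ≤ n := Nat.div_mul_le_self n D
  -- The constant `288 = 12 * 24` makes the `k`-walk miss probability at least `exp (-L / 12)`,
  -- better than the required `k ^ (-1/4)`.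
  have hx : 12 * s / n = L / (24 * k) := by rw [hn]; field_simp; norm_num
  have hx2 : L / (24 * k) ≤ 1 / 24 := by
    rw [div_le_div_iff₀ (by positivity) (by norm_num)]; linarith
  have hb : ∀ v : Fin n, 1 - L / (24 * k) ≤ avgMissProb ⌊s ^ 2⌋₊ {v} := fun v => by
    have := one_sub_avgMissProb_singleton_le hs ht v
    rw [hx] at this; linarith
  have hexp : Real.exp (-(D / s)) ≤ Real.exp (-(7 * L)) := by
    gcongr
    rw [le_div_iff₀ hs0]; linarith
  refine measure_uncovered_ge (ι := Fin (n / D)) (fun j => ((j.val * D : ℕ) : Fin n))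
    (δ := 6 * Real.exp (-(7 * L))) (by positivity) ?_ (fun j => ?_) (fun j l hjl => ?_) ?_
  · have e : 4 * (k : ℝ) * (6 * Real.exp (-(7 * L))) = 24 * Real.exp (-L) ^ 6 := by
      rw [← Real.exp_nat_mul]
      have : (k : ℝ) = Real.exp L := (Real.exp_log hk0).symm
      rw [this, show 4 * Real.exp L * (6 * Real.exp (-(7 * L)))
        = 24 * (Real.exp L * Real.exp (-(7 * L))) by ring, ← Real.exp_add]
      congr 2; push_cast; ring
    have h2 : Real.exp (-L) ≤ 1 / 2 := by
      rw [Real.exp_neg, Real.exp_log hk0, one_div]; gcongr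
    have h3 : Real.exp (-L) ^ 6 ≤ (1 / 2) ^ 6 := by gcongr
    rw [e]
    norm_num at h3
    linarith
  · linarith [hb ((j.val * D : ℕ) : Fin n)]
  · have key : ∀ j l : Fin (n / D), j < l → 1 - avgMissProb ⌊s ^ 2⌋₊
        {((j.val * D : ℕ) : Fin n), ((l.val * D : ℕ) : Fin n)} ≤ 6 * Real.exp (-(7 * L)) := by
      intro j l hlt
      have hlt' : j.val < l.val := hlt
      obtain ⟨e, he⟩ : ∃ e, l.val = j.val + (e + 1) := ⟨l.val - j.val - 1, by omega⟩
      have hv : ((l.val * D : ℕ) : Fin n)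
          = ((j.val * D : ℕ) : Fin n) + (((e + 1) * D : ℕ) : Fin n) := by
        rw [← Nat.cast_add, he]; congr 1; ring
      rw [hv]
      refine (one_sub_avgMissProb_pair_le hs0 ht hD0 ?_ ?_ _).trans (by gcongr)
      · exact Nat.le_mul_of_pos_left D (Nat.succ_pos e)
      -- One further gap fits inside the cycle, so the two vertices are also `D` apart the other way
      -- round.
      · have h1 : e + 1 + 1 ≤ n / D := by have := l.isLt; omega
        calc (e + 1) * D + D = (e + 1 + 1) * D := by ring
          _ ≤ n / D * D := by gcongr
          _ ≤ n := hN
    rcases lt_or_gt_of_ne hjl with h | h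
    · exact key j l h
    · rw [Set.pair_comm]; exact key l j h
  · have hbk : ∀ v : Fin n, Real.exp (-(L / 4)) ≤ avgMissProb ⌊s ^ 2⌋₊ {v} ^ k := fun v => by
      calc Real.exp (-(L / 4)) ≤ Real.exp (k * -(2 * (L / (24 * k)))) := by
            gcongr
            have : (k : ℝ) * -(2 * (L / (24 * k))) = -(L / 12) := by field_simp; norm_num
            rw [this]; linarith
        _ = Real.exp (-(2 * (L / (24 * k)))) ^ k := Real.exp_nat_mul _ _
        _ ≤ (1 - L / (24 * k)) ^ k := by
            gcongr
            exact exp_neg_two_mul_le (by positivity) (by linarith)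
        _ ≤ _ := by
            gcongr
            · linarith
            · exact hb v
    have hcard := card_spaced_ge hk' hs hn hDlt hD0
    set y := Real.exp (L / 4)
    have hy1 : 1 ≤ y := Real.one_le_exp (by positivity)
    calc (1 / 4 : ℝ) ≤ y := by linarith
      _ = y ^ 2 * Real.exp (-(L / 4)) := by rw [Real.exp_neg]; field_simp; rfl
      _ ≤ (n / D : ℕ) * Real.exp (-(L / 4)) := by gcongr
      _ = ∑ _j : Fin (n / D), Real.exp (-(L / 4)) := by
          rw [Finset.sum_const, Finset.card_univ, Fintype.card_fin, nsmul_eq_mul]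
      _ ≤ _ := Finset.sum_le_sum fun j _ => hbk _

lemma le_stationaryCoverTime_cycleGraph (m k : ℕ) (hk : 2 ≤ k)
    (hkn : (k : ℝ) ≤ (m + 3 : ℕ) * Real.log (m + 3 : ℕ)) :
    ENNReal.ofReal (1 / 497664 * ((((m + 3 : ℕ) : ℝ) / k) ^ 2 * Real.log k ^ 2))
      ≤ stationaryCoverTime (SimpleGraph.cycleGraph (m + 3)) k := by
  have hk' : (2 : ℝ) ≤ k := by exact_mod_cast hk
  have hk0 : (0 : ℝ) < k := by linarith
  have hL0 : 0 < Real.log k := Real.log_pos (by linarith)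
  set s : ℝ := 1 / 288 * (((m + 3 : ℕ) : ℝ) / k) * Real.log k with hs
  have hs0 : 0 ≤ s := by positivity
  have e : 1 / 497664 * ((((m + 3 : ℕ) : ℝ) / k) ^ 2 * Real.log k ^ 2) = s ^ 2 * (1 / 6) := by
    rw [hs]; ring
  rw [e]
  -- For `s < 1`, an expected time of `1/6` suffices, from being uncovered at time `0`. Otherwise
  -- time `⌊s ^ 2⌋₊` is used, and the `t + 1` in `le_stationaryCoverTime` absorbs the rounding.
  rcases lt_or_ge s 1 with h | h
  · refine le_trans (ENNReal.ofReal_le_ofReal ?_)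
      (le_stationaryCoverTime (measure_uncovered_zero_ge hkn))
    push_cast
    gcongr
    nlinarith
  · refine le_trans (ENNReal.ofReal_le_ofReal ?_)
      (le_stationaryCoverTime (measure_uncovered_floor_ge hk h ?_))
    · gcongr
      exact (Nat.lt_floor_add_one _).le
    · rw [hs]; field_simp

end LowerBound

end

theorem theorem5p1 :
    ∃ c C : ℝ, 0 < c ∧ 0 < C ∧ ∀ n k : ℕ, 3 ≤ n → 2 ≤ k →
      stationaryCoverTime (SimpleGraph.cycleGraph n) k
          ≤ ENNReal.ofReal (C * (((n : ℝ) / k) ^ 2 * Real.log k ^ 2)) ∧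
      ((k : ℝ) ≤ n * Real.log n →
        ENNReal.ofReal (c * (((n : ℝ) / k) ^ 2 * Real.log k ^ 2))
          ≤ stationaryCoverTime (SimpleGraph.cycleGraph n) k) := by
  refine ⟨1 / 497664, 100000000, by norm_num, by norm_num, fun n k hn hk => ?_⟩
  obtain ⟨m, rfl⟩ : ∃ m, n = m + 3 := ⟨n - 3, by omega⟩
  exact ⟨stationaryCoverTime_cycleGraph_le m k hk, le_stationaryCoverTime_cycleGraph m k hk⟩
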